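/- Let $A$ be a separable unital UHF algebra, that is, a unital C*-algebra which is the direct limit (closure of the union) of an increasing sequence of unital subalgebras isomorphic to full matrix algebras $M_k(\mathbb C)$, $k\ge 1$. Formulas are those of the logic of metric structures for C*-algebras: atomic formulas $\|t\|$ with $t$ a *-polynomial; $f(\varphi,\psi)$ for continuous $f\colon[0,\infty)^2\to[0,\infty)$; $\inf_{\|x\|\le k}\varphi$ and $\sup_{\|x\|\le k}\varphi$ for $k\in\mathbb N$. The theory $\mathrm{Th}(A)$ is the set of all conditions $\varphi\le r$, $\varphi\ge r$ ($\varphi$ a formula without free variables, $r\ge 0$) that hold in $A$, and its models are the C*-algebras satisfying all these conditions. The type of a tuple $\bar a$ in the $n$-th power $(A_1)^n$ of the unit ball is the set of all $n$-ary conditions satisfied by $\bar a$; it is principal if, for the models $B$ of $\mathrm{Th}(A)$, its set of realizations $D^B\subseteq (B_1)^n$ is nonempty and there are formulas $\varphi_j$, independent of $B$, with $\varphi_j(\bar b)^B\to\operatorname{dist}(\bar b,D^B)$ (max metric) uniformly in $\bar b\in(B_1)^n$ and in $B$. Then: (1) $A$ is a prime model of $\mathrm{Th}(A)$: for every C*-algebra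 $B$ that is a model of $\mathrm{Th}(A)$ there is an elementary embedding of $A$ into $B$, i.e. a *-homomorphism preserving the values of all formulas at all tuples. (2) $A$ is an atomic model of $\mathrm{Th}(A)$: for every $n$, the type of every $\bar a\in(A_1)^n$ is principal (in particular this holds for tuples lying in a unital copy of a matrix algebra). (3) For every $k$, any two unital *-homomorphisms $M_k(\mathbb C)\to A$ are conjugate by a unitary of $A$, and for every $m$ the $m$-tuples whose entries all lie in one unital copy of some $M_k(\mathbb C)$, $k\ge1$, are dense in $A^m$. -/

import Mathlib

open scoped NNReal

universe u v

namespace CStarLogic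

/-- Terms of the language of C*-algebras with variables among `x_0, …, x_{n-1}`: *-polynomials
with complex coefficients (and without constant term, since C*-algebras need not be unital). -/
inductive Term (n : ℕ) : Type
  | var : Fin n → Term n
  | zero : Term n
  | add : Term n → Term n → Term n
  | mul : Term n → Term n → Term n
  | smul : ℂ → Term n → Term n
  | star : Term n → Term n

/-- Formulas of the logic of metric structures for C*-algebras, with free variables among
`x_0, …, x_{n-1}`: the atomic formulas `‖t‖`, the formulas `f(φ, ψ)` for continuous
`f : [0,∞)² → [0,∞)`, and `inf_{‖x_n‖ ≤ k} φ`, `sup_{‖x_n‖ ≤ k} φ` for natural numbers `k`. -/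
inductive Formula : ℕ → Type
  | norm {n : ℕ} : Term n → Formula n
  | conn {n : ℕ} : C(ℝ≥0 × ℝ≥0, ℝ≥0) → Formula n → Formula n → Formula n
  | inf {n : ℕ} : ℕ → Formula (n + 1) → Formula n
  | sup {n : ℕ} : ℕ → Formula (n + 1) → Formula n

section Semantics

variable {A : Type u} [NonUnitalCStarAlgebra A]

/-- The interpretation of a term at a tuple of elements of a C*-algebra. -/
def Term.eval {n : ℕ} : Term n → (Fin n → A) → A
  | .var i, a => a i
  | .zero, _ => 0
  | .add s t, a => s.eval a + t.eval a
  | .mul s t, a => s.eval a * t.eval a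
  | .smul c t, a => c • t.eval a
  | .star t, a => Star.star (t.eval a)

/-- The value `φ(a)^A` of a formula at a tuple of elements of a C*-algebra. The infima and
suprema below are over nonempty sets, and the sets are bounded because formulas are bounded
on bounded sets. -/
noncomputable def Formula.eval : {n : ℕ} → Formula n → (Fin n → A) → ℝ≥0
  | _, .norm t, a => ‖t.eval a‖₊
  | _, .conn f φ ψ, a => f (φ.eval a, ψ.eval a)
  | _, .inf k φ, a =>
      ⨅ x : {x : A // ‖x‖ ≤ (k : ℝ)}, φ.eval (Fin.snoc (α := fun _ => A) a x.1)
  | _, .sup k φ, a =>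
      ⨆ x : {x : A // ‖x‖ ≤ (k : ℝ)}, φ.eval (Fin.snoc (α := fun _ => A) a x.1)

end Semantics

/-- An `n`-ary condition: `φ ≤ r` or `φ ≥ r`, with `φ` an `n`-ary formula and `r ≥ 0`. -/
inductive Condition (n : ℕ) : Type
  | le : Formula n → ℝ≥0 → Condition n
  | ge : Formula n → ℝ≥0 → Condition n

/-- Satisfaction of a condition by a tuple. -/
def Condition.Sat {A : Type u} [NonUnitalCStarAlgebra A] {n : ℕ} :
    Condition n → (Fin n → A) → Prop
  | .le φ r, a => φ.eval a ≤ r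
  | .ge φ r, a => r ≤ φ.eval a

/-- The (complete) theory of a C*-algebra: all the closed conditions that it satisfies. -/
def theoryOf (A : Type u) [NonUnitalCStarAlgebra A] : Set (Condition 0) :=
  {c | c.Sat (Fin.elim0 : Fin 0 → A)}

/-- A C*-algebra `B` is a model of `T`. (The axioms of C*-algebras are always understood to be
part of `T`, so only C*-algebras, unital or not, are considered as models.) -/
def IsModel (T : Set (Condition 0)) (B : Type v) [NonUnitalCStarAlgebra B] : Prop :=
  ∀ c ∈ T, c.Sat (Fin.elim0 : Fin 0 → B)

/-- Elementary embeddings: *-homomorphisms that preserve the values of all formulas. Such a map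
is isometric, and it is an isomorphism onto an elementary submodel. -/
def IsElementary {A : Type u} {B : Type v} [NonUnitalCStarAlgebra A] [NonUnitalCStarAlgebra B]
    (j : A →⋆ₙₐ[ℂ] B) : Prop :=
  ∀ (n : ℕ) (φ : Formula n) (a : Fin n → A), φ.eval (fun i => j (a i)) = φ.eval a

/-- `A` is a prime model of `T`: it is a model of `T` that embeds elementarily into every model
of `T`. -/
def IsPrimeModel (T : Set (Condition 0)) (A : Type u) [NonUnitalCStarAlgebra A] : Prop :=
  IsModel T A ∧ ∀ (B : Type v) [NonUnitalCStarAlgebra B], IsModel T B →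
    ∃ j : A →⋆ₙₐ[ℂ] B, IsElementary j

/-- The `n`-th power `(A_1)^n` of the unit ball. -/
def unitBall (n : ℕ) (A : Type u) [NonUnitalCStarAlgebra A] : Set (Fin n → A) :=
  {a | ∀ i, ‖a i‖ ≤ 1}

/-- The complete type (over the empty set) of a tuple. -/
def typeOf {A : Type u} [NonUnitalCStarAlgebra A] {n : ℕ} (a : Fin n → A) : Set (Condition n) :=
  {c | c.Sat a}

/-- The set of realizations, in the unit ball, of an `n`-type. -/
def realizations {n : ℕ} (p : Set (Condition n)) (B : Type v) [NonUnitalCStarAlgebra B] :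
    Set (Fin n → B) :=
  {b | b ∈ unitBall n B ∧ ∀ c ∈ p, c.Sat b}

/-- An assignment `D` of subsets of `(B_1)^n` to the models `B` of `T` is uniformly definable
if there are formulas `φ_j` that converge to the distance to `D B` on `(B_1)^n`, uniformly on
`(B_1)^n` and uniformly over all models `B` of `T`. The metric on `n`-tuples is the max metric. -/
def UniformlyDefinable (T : Set (Condition 0)) {n : ℕ}
    (D : ∀ (B : Type v) [NonUnitalCStarAlgebra B], Set (Fin n → B)) : Prop :=
  ∃ φ : ℕ → Formula n, ∀ ε : ℝ, 0 < ε → ∃ N : ℕ, ∀ j ≥ N,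
    ∀ (B : Type v) [NonUnitalCStarAlgebra B], IsModel T B →
      ∀ b ∈ unitBall n B, |((φ j).eval b : ℝ) - Metric.infDist b (D B)| ≤ ε

/-- A type is principal over the complete theory `T` if its set of realizations is (nonempty and)
definable in all models of `T`. -/
def IsPrincipal (T : Set (Condition 0)) {n : ℕ} (p : Set (Condition n)) : Prop :=
  (∀ (B : Type v) [NonUnitalCStarAlgebra B], IsModel T B → (realizations p B).Nonempty) ∧
    UniformlyDefinable.{v} T (fun B _ => realizations p B)

/-- `A` is an atomic model of `T`: all types over the empty set realized in `A` are principal. -/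
def IsAtomicModel (T : Set (Condition 0)) (A : Type u) [NonUnitalCStarAlgebra A] : Prop :=
  IsModel T A ∧ ∀ (n : ℕ), ∀ a ∈ unitBall n A, IsPrincipal.{v} T (typeOf a)

end CStarLogic

/-- Separable unital UHF algebras: unital C*-algebras that are the direct limit (the closure of
the union) of an increasing sequence of unital subalgebras isomorphic to full matrix algebras
`M_k(ℂ)`, `k ≥ 1`. -/
def IsSeparableUHF (A : Type u) [CStarAlgebra A] : Prop :=
  ∃ (k : ℕ → ℕ) (φ : ∀ n, Matrix (Fin (k n)) (Fin (k n)) ℂ →⋆ₐ[ℂ] A),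
    (∀ n, 0 < k n) ∧ (∀ n, Function.Injective (φ n)) ∧
    Monotone (fun n => Set.range (φ n)) ∧ Dense (⋃ n, Set.range (φ n))

/-- The `m`-tuples all of whose entries lie in one unital copy of a full matrix algebra. -/
def matricialTuples (m : ℕ) (A : Type u) [CStarAlgebra A] : Set (Fin m → A) :=
  {a | ∃ (k : ℕ) (φ : Matrix (Fin k) (Fin k) ℂ →⋆ₐ[ℂ] A),
    0 < k ∧ Function.Injective φ ∧ ∀ i, a i ∈ Set.range φ}

/-! The engine is weak stability of matrix units: elements that almost satisfy the relations of the
first column of a system of matrix units are close to an exact column, with estimates depending only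
on the matrix size (`exists_starAlgHom_near`). These relations can be written as formulas. With a
large enough weight `C`, the formula `matricialDist` therefore measures, uniformly over all unital
C*-algebras, how far a tuple is from the tuples `ψ ∘ c` with `ψ` a unital *-homomorphism of a matrix
algebra (`exists_starAlgHom_of_matricialDist_lt`).

The second ingredient is uniqueness (`exists_unitary_conj`). Two unital *-homomorphisms from a
matrix algebra to a UHF algebra can be perturbed into a common matrix algebra of the defining
sequence, where a trace count makes them conjugate; close homomorphisms are conjugate as well. A
formula hence has a single value at all tuples `ψ ∘ c` in `A`. Weak stability turns this fact into
approximate sentences, so the value is the same in every model (`eval_map_eq_of_isModel`).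

A unital *-homomorphism from one matrix algebra of the sequence into a model therefore extends to
the next one with arbitrarily small error. Making the errors summable gives a limit on `A`, which is
elementary because formulas are continuous and values agree on the matrix algebras
(`exists_elementary_limit`). This proves primeness. For atomicity, approximate `a` by `φ m ∘ c`. If
`b` is at formula distance `r` from copies of `c`, then `b` is nearly `r`-close to some `θ ∘ c`, and
`θ` is close to an elementary embedding, whose value at `a` realizes the type. Conversely
`matricialDist` is 1-Lipschitz and small on realizations. -/

namespace CStarLogic

/-! ### Continuity and isomorphism invariance of formulas -/

section Semantics

variable {A : Type u} [NonUnitalCStarAlgebra A]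

/-- On each ball, a term is bounded and uniformly continuous. -/
theorem Term.bounded_uniform {n : ℕ} (t : Term n) (R : ℝ) :
    (∃ M : ℝ, 0 ≤ M ∧ ∀ a : Fin n → A, (∀ i, ‖a i‖ ≤ R) → ‖t.eval a‖ ≤ M) ∧
    ∀ ε > 0, ∃ δ > 0, ∀ a b : Fin n → A, (∀ i, ‖a i‖ ≤ R) → (∀ i, ‖b i‖ ≤ R) →
      (∀ i, ‖a i - b i‖ ≤ δ) → ‖t.eval a - t.eval b‖ ≤ ε := by
  induction t with
  | var i =>
    exact ⟨⟨max R 0, le_max_right _ _, fun a ha => (ha i).trans (le_max_left _ _)⟩,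
      fun ε hε => ⟨ε, hε, fun a b _ _ h => h i⟩⟩
  | zero =>
    exact ⟨⟨0, le_rfl, fun a _ => by simp [Term.eval]⟩,
      fun ε hε => ⟨1, one_pos, fun a b _ _ _ => by simpa [Term.eval] using hε.le⟩⟩
  | add s t hs ht =>
    obtain ⟨⟨M, hM0, hM⟩, us⟩ := hs
    obtain ⟨⟨N, hN0, hN⟩, ut⟩ := ht
    refine ⟨⟨M + N, by positivity, fun a ha =>
      (norm_add_le _ _).trans (add_le_add (hM a ha) (hN a ha))⟩, fun ε hε => ?_⟩
    obtain ⟨δ₁, h₁, H₁⟩ := us (ε / 2) (half_pos hε)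
    obtain ⟨δ₂, h₂, H₂⟩ := ut (ε / 2) (half_pos hε)
    refine ⟨min δ₁ δ₂, lt_min h₁ h₂, fun a b ha hb hab => ?_⟩
    have e₁ := H₁ a b ha hb fun i => (hab i).trans (min_le_left _ _)
    have e₂ := H₂ a b ha hb fun i => (hab i).trans (min_le_right _ _)
    calc ‖s.eval a + t.eval a - (s.eval b + t.eval b)‖
        = ‖(s.eval a - s.eval b) + (t.eval a - t.eval b)‖ := by congr 1; abel
      _ ≤ ε / 2 + ε / 2 := (norm_add_le _ _).trans (add_le_add e₁ e₂)
      _ = ε := add_halves ε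
  | mul s t hs ht =>
    obtain ⟨⟨M, hM0, hM⟩, us⟩ := hs
    obtain ⟨⟨N, hN0, hN⟩, ut⟩ := ht
    refine ⟨⟨M * N, by positivity, fun a ha =>
      (norm_mul_le _ _).trans (mul_le_mul (hM a ha) (hN a ha) (norm_nonneg _) hM0)⟩,
      fun ε hε => ?_⟩
    obtain ⟨δ₁, h₁, H₁⟩ := us (ε / 2 / (N + 1)) (by positivity)
    obtain ⟨δ₂, h₂, H₂⟩ := ut (ε / 2 / (M + 1)) (by positivity)
    refine ⟨min δ₁ δ₂, lt_min h₁ h₂, fun a b ha hb hab => ?_⟩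
    have e₁ := H₁ a b ha hb fun i => (hab i).trans (min_le_left _ _)
    have e₂ := H₂ a b ha hb fun i => (hab i).trans (min_le_right _ _)
    calc ‖s.eval a * t.eval a - s.eval b * t.eval b‖
        = ‖(s.eval a - s.eval b) * t.eval a + s.eval b * (t.eval a - t.eval b)‖ := by
          congr 1; noncomm_ring
      _ ≤ ‖s.eval a - s.eval b‖ * ‖t.eval a‖ + ‖s.eval b‖ * ‖t.eval a - t.eval b‖ :=
          (norm_add_le _ _).trans (add_le_add (norm_mul_le _ _) (norm_mul_le _ _))
      _ ≤ ε / 2 / (N + 1) * (N + 1) + (M + 1) * (ε / 2 / (M + 1)) := by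
          gcongr
          · exact (hN a ha).trans (by linarith)
          · exact (hM b hb).trans (by linarith)
      _ = ε := by field_simp; ring
  | smul c t ht =>
    obtain ⟨⟨N, hN0, hN⟩, ut⟩ := ht
    refine ⟨⟨‖c‖ * N, by positivity, fun a ha =>
      (norm_smul_le _ _).trans (mul_le_mul_of_nonneg_left (hN a ha) (norm_nonneg _))⟩,
      fun ε hε => ?_⟩
    obtain ⟨δ₂, h₂, H₂⟩ := ut (ε / (‖c‖ + 1)) (by positivity)
    refine ⟨δ₂, h₂, fun a b ha hb hab => ?_⟩
    calc ‖c • t.eval a - c • t.eval b‖ = ‖c‖ * ‖t.eval a - t.eval b‖ := by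
          rw [← smul_sub, norm_smul]
      _ ≤ (‖c‖ + 1) * (ε / (‖c‖ + 1)) := by
          gcongr
          · linarith
          · exact H₂ a b ha hb hab
      _ = ε := by field_simp
  | star t ht =>
    obtain ⟨⟨N, hN0, hN⟩, ut⟩ := ht
    refine ⟨⟨N, hN0, fun a ha => by simpa [Term.eval] using hN a ha⟩, fun ε hε => ?_⟩
    obtain ⟨δ₂, h₂, H₂⟩ := ut ε hε
    refine ⟨δ₂, h₂, fun a b ha hb hab => ?_⟩
    simpa only [Term.eval, ← star_sub, norm_star] using H₂ a b ha hb hab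

theorem norm_snoc_le {n : ℕ} {a : Fin n → A} {x : A} {R S : ℝ} (ha : ∀ i, ‖a i‖ ≤ R)
    (hx : ‖x‖ ≤ S) (i : Fin (n + 1)) :
    ‖(Fin.snoc (α := fun _ => A) a x : Fin (n + 1) → A) i‖ ≤ max R S := by
  refine Fin.lastCases ?_ (fun j => ?_) i
  · simpa using Or.inr hx
  · simpa using Or.inl (ha j)

instance nonempty_ball (k : ℕ) : Nonempty {x : A // ‖x‖ ≤ (k : ℝ)} :=
  ⟨⟨0, by simp⟩⟩

/-- On each ball, a formula is bounded and uniformly continuous. -/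
theorem Formula.bounded_uniform {n : ℕ} (φ : Formula n) : ∀ R : ℝ,
    (∃ M : ℝ≥0, ∀ a : Fin n → A, (∀ i, ‖a i‖ ≤ R) → φ.eval a ≤ M) ∧
    ∀ ε : ℝ≥0, 0 < ε → ∃ δ : ℝ, 0 < δ ∧ ∀ a b : Fin n → A,
      (∀ i, ‖a i‖ ≤ R) → (∀ i, ‖b i‖ ≤ R) →
      (∀ i, ‖a i - b i‖ ≤ δ) → φ.eval a ≤ φ.eval b + ε := by
  induction φ with
  | norm t =>
    intro R
    obtain ⟨⟨M, hM0, hM⟩, ut⟩ := t.bounded_uniform (A := A) R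
    refine ⟨⟨⟨M, hM0⟩, fun a ha => hM a ha⟩, fun ε hε => ?_⟩
    obtain ⟨δ, hδ, H⟩ := ut ε hε
    refine ⟨δ, hδ, fun a b ha hb hab => ?_⟩
    have h₁ := norm_sub_norm_le (t.eval a) (t.eval b)
    have h₂ := H a b ha hb hab
    have : ‖t.eval a‖ ≤ ‖t.eval b‖ + ε := by linarith
    exact_mod_cast this
  | conn f φ ψ hφ hψ =>
    intro R
    obtain ⟨⟨M, hM⟩, uφ⟩ := hφ R
    obtain ⟨⟨N, hN⟩, uψ⟩ := hψ R
    have hK : IsCompact (Set.Icc 0 M ×ˢ Set.Icc 0 N : Set (ℝ≥0 × ℝ≥0)) :=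
      isCompact_Icc.prod isCompact_Icc
    have mem : ∀ a : Fin _ → A, (∀ i, ‖a i‖ ≤ R) →
        (φ.eval a, ψ.eval a) ∈ (Set.Icc 0 M ×ˢ Set.Icc 0 N : Set (ℝ≥0 × ℝ≥0)) :=
      fun a ha => ⟨⟨zero_le, hM a ha⟩, zero_le, hN a ha⟩
    constructor
    · obtain ⟨L, hL⟩ := (hK.image f.continuous).bddAbove
      exact ⟨L, fun a ha => hL ⟨_, mem a ha, rfl⟩⟩
    · intro ε hε
      have hf := hK.uniformContinuousOn_of_continuous f.continuous.continuousOn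
      rw [Metric.uniformContinuousOn_iff_le] at hf
      obtain ⟨η, hη, H⟩ := hf ε hε
      obtain ⟨δ₁, h₁, H₁⟩ := uφ ⟨η, hη.le⟩ hη
      obtain ⟨δ₂, h₂, H₂⟩ := uψ ⟨η, hη.le⟩ hη
      refine ⟨min δ₁ δ₂, lt_min h₁ h₂, fun a b ha hb hab => ?_⟩
      have hba : ∀ i, ‖b i - a i‖ ≤ min δ₁ δ₂ := fun i => by rw [norm_sub_rev]; exact hab i
      have e₁ := H₁ a b ha hb fun i => (hab i).trans (min_le_left _ _)
      have e₂ := H₂ a b ha hb fun i => (hab i).trans (min_le_right _ _)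
      have e₃ := H₁ b a hb ha fun i => (hba i).trans (min_le_left _ _)
      have e₄ := H₂ b a hb ha fun i => (hba i).trans (min_le_right _ _)
      have := H _ (mem a ha) _ (mem b hb) (by
        rw [Prod.dist_eq, NNReal.dist_eq, NNReal.dist_eq]
        have e₁ : (φ.eval a : ℝ) ≤ φ.eval b + η := e₁
        have e₂ : (ψ.eval a : ℝ) ≤ ψ.eval b + η := e₂
        have e₃ : (φ.eval b : ℝ) ≤ φ.eval a + η := e₃
        have e₄ : (ψ.eval b : ℝ) ≤ ψ.eval a + η := e₄
        refine max_le (abs_le.2 ⟨?_, ?_⟩) (abs_le.2 ⟨?_, ?_⟩) <;> dsimp only <;> linarith)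
      rw [NNReal.dist_eq] at this
      have := (abs_le.1 this).2
      change f (φ.eval a, ψ.eval a) ≤ f (φ.eval b, ψ.eval b) + ε
      rw [← NNReal.coe_le_coe]
      push_cast
      linarith
  | inf k φ hφ =>
    intro R
    obtain ⟨⟨M, hM⟩, uφ⟩ := hφ (max R k)
    constructor
    · refine ⟨M, fun a ha => ?_⟩
      exact (ciInf_le' _ (⟨0, by simp⟩ : {x : A // ‖x‖ ≤ (k : ℝ)})).trans
        (hM _ (norm_snoc_le ha (by simp)))
    · intro ε hε
      obtain ⟨δ, hδ, H⟩ := uφ ε hε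
      refine ⟨δ, hδ, fun a b ha hb hab => ?_⟩
      rw [← tsub_le_iff_right]
      refine le_ciInf fun x => ?_
      rw [tsub_le_iff_right]
      refine (ciInf_le' _ x).trans (H _ _ (norm_snoc_le ha x.2) (norm_snoc_le hb x.2) fun i => ?_)
      refine Fin.lastCases ?_ (fun j => ?_) i
      · simpa using hδ.le
      · simpa using hab j
  | sup k φ hφ =>
    intro R
    obtain ⟨⟨M, hM⟩, uφ⟩ := hφ (max R k)
    constructor
    · exact ⟨M, fun a ha => ciSup_le fun x => hM _ (norm_snoc_le ha x.2)⟩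
    · intro ε hε
      obtain ⟨δ, hδ, H⟩ := uφ ε hε
      refine ⟨δ, hδ, fun a b ha hb hab => ciSup_le fun x => ?_⟩
      refine (H _ (Fin.snoc (α := fun _ => A) b x.1) (norm_snoc_le ha x.2)
        (norm_snoc_le hb x.2) fun i => ?_).trans ?_
      · refine Fin.lastCases ?_ (fun j => ?_) i
        · simpa using hδ.le
        · simpa using hab j
      · gcongr
        exact le_ciSup (f := fun x : {x : A // ‖x‖ ≤ (k : ℝ)} =>
          φ.eval (Fin.snoc (α := fun _ => A) b x.1))
          ⟨M, by rintro _ ⟨y, rfl⟩; exact hM _ (norm_snoc_le hb y.2)⟩ x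

theorem exists_norm_le {n : ℕ} (a : Fin n → A) : ∃ R : ℕ, ∀ i, ‖a i‖ ≤ R := by
  obtain ⟨R, hR⟩ := exists_nat_ge ‖a‖
  exact ⟨R, fun i => (norm_le_pi_norm a i).trans hR⟩

/-- Suprema are tested with `≤` and infima with `<`, since extrema need not be attained. Boundedness
of `φ` on balls is essential here: an unbounded supremum in `ℝ≥0` would take the default value 0. -/
theorem Formula.eval_sup_le_iff {n k : ℕ} (φ : Formula (n + 1)) (a : Fin n → A) (s : ℝ≥0) :
    (Formula.sup k φ).eval a ≤ s ↔
      ∀ x : A, ‖x‖ ≤ k → φ.eval (Fin.snoc (α := fun _ => A) a x) ≤ s := by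
  obtain ⟨R, hR⟩ := exists_norm_le a
  obtain ⟨⟨M, hM⟩, -⟩ := φ.bounded_uniform (A := A) (max R k)
  have bdd : BddAbove (Set.range fun x : {x : A // ‖x‖ ≤ (k : ℝ)} =>
      φ.eval (Fin.snoc (α := fun _ => A) a x.1)) :=
    ⟨M, by rintro _ ⟨y, rfl⟩; exact hM _ (norm_snoc_le hR y.2)⟩
  exact ⟨fun h x hx => (le_ciSup bdd ⟨x, hx⟩).trans h, fun h => ciSup_le fun x => h x.1 x.2⟩

theorem Formula.eval_inf_lt_iff {n k : ℕ} (φ : Formula (n + 1)) (a : Fin n → A) (s : ℝ≥0) :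
    (Formula.inf k φ).eval a < s ↔
      ∃ x : A, ‖x‖ ≤ k ∧ φ.eval (Fin.snoc (α := fun _ => A) a x) < s := by
  constructor
  · intro h
    obtain ⟨x, hx⟩ := exists_lt_of_ciInf_lt h
    exact ⟨x.1, x.2, hx⟩
  · rintro ⟨x, hx, h⟩
    exact (ciInf_le' _ (⟨x, hx⟩ : {x : A // ‖x‖ ≤ (k : ℝ)})).trans_lt h

theorem Formula.continuous_eval {n : ℕ} (φ : Formula n) :
    Continuous (fun a : Fin n → A => φ.eval a) := by
  rw [Metric.continuous_iff]
  intro b ε hε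
  obtain ⟨-, u⟩ := φ.bounded_uniform (A := A) (‖b‖ + 1)
  obtain ⟨δ, hδ, H⟩ := u ⟨ε / 2, (half_pos hε).le⟩ (half_pos hε)
  refine ⟨min δ 1, lt_min hδ one_pos, fun a hab => ?_⟩
  rw [dist_eq_norm] at hab
  have hd : ∀ i, ‖a i - b i‖ ≤ min δ 1 := fun i => (norm_le_pi_norm (a - b) i).trans hab.le
  have hb : ∀ i, ‖b i‖ ≤ ‖b‖ + 1 := fun i => (norm_le_pi_norm b i).trans (by linarith)
  have ha : ∀ i, ‖a i‖ ≤ ‖b‖ + 1 := fun i => by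
    have := norm_sub_norm_le (a i) (b i)
    have := norm_le_pi_norm b i
    have := (hd i).trans (min_le_right _ _)
    linarith
  have e₁ := H a b ha hb fun i => (hd i).trans (min_le_left _ _)
  have e₂ := H b a hb ha fun i => by rw [norm_sub_rev]; exact (hd i).trans (min_le_left _ _)
  have e₁ : (φ.eval a : ℝ) ≤ φ.eval b + ε / 2 := e₁
  have e₂ : (φ.eval b : ℝ) ≤ φ.eval a + ε / 2 := e₂
  rw [NNReal.dist_eq]
  exact (abs_le.2 ⟨by linarith, by linarith⟩ : _ ≤ ε / 2).trans_lt (half_lt_self hε)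

theorem Term.eval_equiv {B : Type v} [NonUnitalCStarAlgebra B] (α : A ≃⋆ₐ[ℂ] B) {n : ℕ}
    (t : Term n) (a : Fin n → A) : t.eval (fun i => α (a i)) = α (t.eval a) := by
  induction t with
  | var i => rfl
  | zero => exact (map_zero α).symm
  | add s t hs ht => simp only [Term.eval, hs, ht, map_add]
  | mul s t hs ht => simp only [Term.eval, hs, ht, map_mul]
  | smul c t ht => simp only [Term.eval, ht, map_smul]
  | star t ht => simp only [Term.eval, ht, map_star]

theorem comp_snoc {α : Type u} {β : Type v} (f : α → β) {n : ℕ} (a : Fin n → α) (x : α) :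
    (fun i => f ((Fin.snoc (α := fun _ => α) a x : Fin (n + 1) → α) i)) =
      Fin.snoc (α := fun _ => β) (fun i => f (a i)) (f x) := by
  funext i
  refine Fin.lastCases ?_ (fun j => ?_) i <;> simp

/-- The values of formulas are invariant under isomorphisms. -/
theorem Formula.eval_equiv {B : Type v} [NonUnitalCStarAlgebra B] (α : A ≃⋆ₐ[ℂ] B) {n : ℕ}
    (φ : Formula n) : ∀ a : Fin n → A, φ.eval (fun i => α (a i)) = φ.eval a := by
  have e : ∀ k : ℕ, ∃ e : {x : A // ‖x‖ ≤ (k : ℝ)} ≃ {x : B // ‖x‖ ≤ (k : ℝ)},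
      ∀ x, (e x : B) = α x := fun k =>
    ⟨α.toEquiv.subtypeEquiv fun x => by
      rw [← StarAlgEquiv.norm_map α x]; rfl, fun x => rfl⟩
  induction φ with
  | norm t =>
    intro a
    simp only [Formula.eval, Term.eval_equiv]
    exact StarAlgEquiv.nnnorm_map α _
  | conn f φ ψ hφ hψ => intro a; simp only [Formula.eval, hφ, hψ]
  | inf k φ hφ =>
    intro a
    obtain ⟨e, he⟩ := e k
    simp only [Formula.eval]
    exact (Equiv.iInf_congr e fun x => by rw [he, ← comp_snoc α, hφ]).symm
  | sup k φ hφ =>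
    intro a
    obtain ⟨e, he⟩ := e k
    simp only [Formula.eval]
    exact (Equiv.iSup_congr e fun x => by rw [he, ← comp_snoc α, hφ]).symm

end Semantics

/-! ### Derived formulas -/

/-- The sum of a finite family of terms. -/
noncomputable def Term.sum {n : ℕ} {ι : Type*} [Fintype ι] (t : ι → Term n) : Term n :=
  (Finset.univ.toList.map t).foldr Term.add Term.zero

/-- The maximum of a finite list of formulas. -/
noncomputable def Formula.max {n : ℕ} (L : List (Formula n)) : Formula n :=
  L.foldr (Formula.conn ⟨fun p => p.1 ⊔ p.2, by fun_prop⟩) (Formula.norm Term.zero)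

/-- `inf` over the last `m` variables, which range over the unit ball. -/
def Formula.infs {n : ℕ} : (m : ℕ) → Formula (n + m) → Formula n
  | 0, φ => φ
  | m + 1, φ => Formula.infs m (Formula.inf 1 φ)

/-- `sup` over all variables, which range over the ball of radius `R`. -/
def Formula.sups (R : ℕ) : {n : ℕ} → Formula n → Formula 0
  | 0, φ => φ
  | _ + 1, φ => Formula.sups R (Formula.sup R φ)

section Semantics

variable {A : Type u} [NonUnitalCStarAlgebra A]

theorem Term.eval_sum {n : ℕ} {ι : Type*} [Fintype ι] (t : ι → Term n) (a : Fin n → A) :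
    (Term.sum t).eval a = ∑ i, (t i).eval a := by
  have : ∀ L : List ι, ((L.map t).foldr Term.add Term.zero).eval a =
      (L.map fun i => (t i).eval a).sum := by
    intro L
    induction L with
    | nil => rfl
    | cons i L ih => simp only [List.map_cons, List.foldr_cons, Term.eval, ih, List.sum_cons]
  rw [Term.sum, this, Finset.sum_map_toList]

theorem Formula.eval_max_le_iff {n : ℕ} (L : List (Formula n)) (a : Fin n → A) (s : ℝ≥0) :
    (Formula.max L).eval a ≤ s ↔ ∀ φ ∈ L, φ.eval a ≤ s := by
  induction L with
  | nil => simp [Formula.max, Formula.eval, Term.eval]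
  | cons φ L ih =>
    rw [List.forall_mem_cons, ← ih]
    exact sup_le_iff

theorem Formula.eval_infs_lt_iff {n m : ℕ} (φ : Formula (n + m)) (a : Fin n → A) (s : ℝ≥0) :
    (Formula.infs m φ).eval a < s ↔
      ∃ x : Fin m → A, (∀ i, ‖x i‖ ≤ 1) ∧ φ.eval (Fin.append a x) < s := by
  induction m with
  | zero =>
    have h : ∀ x : Fin 0 → A, Fin.append a x = a := fun x => by
      rw [Fin.append_right_nil _ _ rfl]; rfl
    simp [Formula.infs, h]
  | succ m ih =>
    rw [Formula.infs, ih]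
    constructor
    · rintro ⟨x, hx, h⟩
      rw [Formula.eval_inf_lt_iff] at h
      obtain ⟨y, hy, h⟩ := h
      refine ⟨Fin.snoc (α := fun _ => A) x y, fun i => ?_, ?_⟩
      · simpa using norm_snoc_le hx hy i
      · rwa [Fin.append_snoc]
    · rintro ⟨x, hx, h⟩
      refine ⟨Fin.init x, fun i => hx _, ?_⟩
      rw [Formula.eval_inf_lt_iff]
      refine ⟨x (Fin.last m), by simpa using hx _, ?_⟩
      rwa [← Fin.append_snoc, Fin.snoc_init_self]

/-- This turns a uniform estimate over tuples into a sentence, which can then be transferred between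
models. -/
theorem Formula.eval_sups_le_iff {n : ℕ} (R : ℕ) (φ : Formula n) (s : ℝ≥0) :
    (Formula.sups R φ).eval (Fin.elim0 : Fin 0 → A) ≤ s ↔
      ∀ a : Fin n → A, (∀ i, ‖a i‖ ≤ R) → φ.eval a ≤ s := by
  induction n with
  | zero =>
    constructor
    · intro h a _
      rwa [Subsingleton.elim a Fin.elim0]
    · exact fun h => h _ (fun i => i.elim0)
  | succ n ih =>
    rw [Formula.sups, ih]
    simp only [Formula.eval_sup_le_iff]
    constructor
    · intro h a ha
      have := h (Fin.init a) (fun i => ha _) (a (Fin.last n)) (ha _)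
      rwa [Fin.snoc_init_self] at this
    · intro h a ha x hx
      exact h _ fun i => by simpa using norm_snoc_le ha hx i

/-- Sentences have the same value in all models of a complete theory. -/
theorem IsModel.eval_eq {B : Type v} [NonUnitalCStarAlgebra B] (hB : IsModel (theoryOf A) B)
    (φ : Formula 0) : φ.eval (Fin.elim0 : Fin 0 → B) = φ.eval (Fin.elim0 : Fin 0 → A) :=
  le_antisymm (hB (.le φ _) (le_refl (φ.eval (Fin.elim0 : Fin 0 → A))))
    (hB (.ge φ _) (le_refl (φ.eval (Fin.elim0 : Fin 0 → A))))

end Semantics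

end CStarLogic

/-! ### Functional calculus: inverse square roots, polar parts, projections -/

section Perturbation

variable {B : Type v} [CStarAlgebra B]

/-- The inverse square root of a self-adjoint element with positive spectrum. -/
theorem exists_inv_sqrt {G : B} (hG : IsSelfAdjoint G) (hpos : ∀ x ∈ spectrum ℝ G, 0 < x) :
    ∃ S : B, IsSelfAdjoint S ∧ (∀ b, Commute G b → Commute S b) ∧ S * G * S = 1 ∧
      (‖G - 1‖ ≤ 1 / 2 → ‖S - 1‖ ≤ ‖G - 1‖) := by
  have hc : ContinuousOn (fun x : ℝ => (√x)⁻¹) (spectrum ℝ G) :=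
    Real.continuous_sqrt.continuousOn.inv₀ fun x hx => (Real.sqrt_pos.2 (hpos x hx)).ne'
  refine ⟨cfc (fun x : ℝ => (√x)⁻¹) G, cfc_predicate _ _, fun b hb => hb.cfc_real _, ?_, ?_⟩
  · nth_rw 2 [← cfc_id ℝ G]
    rw [← cfc_mul _ _ G hc continuousOn_id,
      ← cfc_mul (fun x : ℝ => (√x)⁻¹ * id x) _ G (hc.mul continuousOn_id) hc]
    rw [cfc_congr (g := fun _ => (1 : ℝ)), cfc_const_one ℝ G]
    intro x hx
    have := Real.sqrt_pos.2 (hpos x hx)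
    have h2 := Real.mul_self_sqrt (hpos x hx).le
    simp only [id]
    field_simp
    nlinarith
  · intro hle
    have h1 : cfc (fun x : ℝ => x - 1) G = G - 1 := by
      rw [cfc_sub (fun x : ℝ => x) (fun _ => 1) G, cfc_id' ℝ G, cfc_const_one ℝ G]
    have h2 : cfc (fun x : ℝ => (√x)⁻¹ - 1) G = cfc (fun x : ℝ => (√x)⁻¹) G - 1 := by
      rw [cfc_sub _ (fun _ => (1 : ℝ)) G hc, cfc_const_one ℝ G]
    rw [← h2]
    refine norm_cfc_le (norm_nonneg _) fun x hx => ?_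
    have hx1 : ‖x - 1‖ ≤ ‖G - 1‖ := by
      rw [← h1]
      exact norm_apply_le_norm_cfc (fun x : ℝ => x - 1) G hx (by fun_prop) hG
    refine le_trans ?_ hx1
    rw [Real.norm_eq_abs] at hx1 ⊢
    have hx2 : 1 / 2 ≤ x := by linarith [(abs_le.1 (hx1.trans hle)).1]
    have hs : 1 / 2 ≤ √x := Real.le_sqrt_of_sq_le (by nlinarith)
    have hss := Real.mul_self_sqrt (hpos x hx).le
    -- The denominator is `√x + x`, which is at least 1 because `x` and `√x` are both at least `1 /
    -- 2`.
    have : (√x)⁻¹ - 1 = (1 - x) / (√x * (1 + √x)) := by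
      field_simp
      nlinarith
    rw [this, abs_div, abs_sub_comm, Real.norm_eq_abs]
    rw [abs_of_pos (by positivity : 0 < √x * (1 + √x))]
    apply div_le_self (abs_nonneg _)
    nlinarith

theorem spectrum_pos_of_norm_sub_one_lt {G : B} (hG : IsSelfAdjoint G) (h : ‖G - 1‖ < 1) :
    ∀ x ∈ spectrum ℝ G, 0 < x := by
  intro x hx
  have h1 : cfc (fun x : ℝ => x - 1) G = G - 1 := by
    rw [cfc_sub (fun x : ℝ => x) (fun _ => 1) G, cfc_id' ℝ G, cfc_const_one ℝ G]
  have := norm_apply_le_norm_cfc (fun x : ℝ => x - 1) G hx (by fun_prop) hG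
  rw [h1, Real.norm_eq_abs] at this
  linarith [(abs_le.1 this).1]

theorem spectrum_star_mul_self_pos {s : B} (hs : IsUnit s) :
    ∀ x ∈ spectrum ℝ (star s * s), 0 < x := by
  intro x hx
  let _ := CStarAlgebra.spectralOrder B
  have := CStarAlgebra.spectralOrderedRing B
  refine lt_of_le_of_ne (spectrum_nonneg_of_nonneg (star_mul_self_nonneg s) hx) ?_
  rintro rfl
  exact (spectrum.zero_notMem ℝ (hs.star.mul hs)) hx

/-- Polar decomposition of an invertible intertwiner: if two unital *-homomorphisms are
intertwined by an invertible element, then they are unitarily conjugate. -/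
theorem exists_unitary_of_isUnit {C : Type u} [Semiring C] [Algebra ℂ C] [StarRing C]
    (φ ψ : C →⋆ₐ[ℂ] B) {s : B} (hs : IsUnit s) (h : ∀ x, s * φ x = ψ x * s) :
    ∃ w : unitary B, ∀ x, ψ x = (w : B) * φ x * star (w : B) := by
  obtain ⟨S, hS, hcomm, hSGS, -⟩ :=
    exists_inv_sqrt (IsSelfAdjoint.star_mul_self s) (spectrum_star_mul_self_pos hs)
  have h' : ∀ x, φ x * star s = star s * ψ x := fun x => by
    have := congrArg star (h (star x))
    simpa only [star_mul, ← map_star, star_star] using this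
  have hGφ : ∀ x, Commute (star s * s) (φ x) := fun x => by
    change star s * s * φ x = φ x * (star s * s)
    rw [mul_assoc, h, ← mul_assoc, ← h', mul_assoc]
  have hSu : IsUnit S := by
    have hG : Commute S (star s * s) := hcomm _ (Commute.refl _)
    refine ⟨⟨S, star s * s * S, by rw [← mul_assoc, hSGS], ?_⟩, rfl⟩
    rw [← hG.eq, hSGS]
  have hw1 : star (s * S) * (s * S) = 1 := by
    rw [star_mul, hS.star_eq, ← hSGS]; noncomm_ring
  -- An invertible isometry is unitary.
  have hw2 : (s * S) * star (s * S) = 1 := by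
    obtain ⟨t, ht⟩ := hs.mul hSu
    rw [← ht] at hw1 ⊢
    calc (t : B) * star (t : B) = t * star (t : B) * (t * (t⁻¹ : Bˣ)) := by simp
      _ = t * (star (t : B) * t) * (t⁻¹ : Bˣ) := by noncomm_ring
      _ = 1 := by rw [hw1, mul_one, Units.mul_inv]
  refine ⟨⟨s * S, Unitary.mem_iff.2 ⟨hw1, hw2⟩⟩, fun x => ?_⟩
  have : s * S * φ x = ψ x * (s * S) := by
    rw [mul_assoc, (hcomm _ (hGφ x)).eq, ← mul_assoc, h, mul_assoc]
  change ψ x = s * S * φ x * star (s * S)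
  rw [this, mul_assoc, hw2, mul_one]

theorem eq_zero_of_isIdempotentElem_of_norm_lt {e : B} (he : IsIdempotentElem e) (h : ‖e‖ < 1) :
    e = 0 := by
  have h1 : ‖e‖ ≤ ‖e‖ * ‖e‖ := by
    conv_lhs => rw [← he.eq]
    exact norm_mul_le _ _
  by_contra hne
  have := norm_pos_iff.2 hne
  nlinarith

/-- The C*-identity gives `‖p‖ = ‖p‖ * ‖p‖`. Applied to the unit, this bounds `‖1‖` without assuming
that the algebra is nontrivial. -/
theorem norm_le_one_of_projection {p : B} (hp : IsSelfAdjoint p) (hpp : p * p = p) : ‖p‖ ≤ 1 := by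
  have h := CStarRing.norm_star_mul_self (x := p)
  rw [hp.star_eq, hpp] at h
  by_contra hne
  nlinarith

/-- An element `a` for which `a` is close to `a* a` is close to a projection. -/
theorem exists_projection_near {a : B} {δ : ℝ} (hδ : δ ≤ 1 / 48) (h : ‖star a * a - a‖ ≤ δ) :
    ∃ p : B, IsSelfAdjoint p ∧ p * p = p ∧ ‖p - a‖ ≤ 109 * δ := by
  have hδ0 : 0 ≤ δ := (norm_nonneg _).trans h
  -- From `‖a‖² = ‖a* a‖ ≤ ‖a‖ + δ`.
  have ha2 : ‖a‖ ≤ 2 := by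
    have h1 : ‖star a * a‖ ≤ ‖a‖ + δ := by
      have := norm_sub_norm_le (star a * a) a
      linarith
    rw [CStarRing.norm_star_mul_self] at h1
    nlinarith [norm_nonneg a]
  set b := star a * a with hb
  have hbsa : IsSelfAdjoint b := IsSelfAdjoint.star_mul_self a
  have hb4 : ‖b‖ ≤ 4 := by
    rw [hb, CStarRing.norm_star_mul_self]
    nlinarith [norm_nonneg a]
  have h' : ‖b - star a‖ ≤ δ := by
    rw [← norm_star, star_sub, star_star, hbsa.star_eq]; exact h
  have hbb : ‖b * b - b‖ ≤ 6 * δ := by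
    calc ‖b * b - b‖ = ‖b * (b - a) + (b - star a) * a‖ := by
          congr 1
          rw [mul_sub, sub_mul, ← hb]; abel
      _ ≤ ‖b‖ * ‖b - a‖ + ‖b - star a‖ * ‖a‖ :=
          (norm_add_le _ _).trans (add_le_add (norm_mul_le _ _) (norm_mul_le _ _))
      _ ≤ 4 * δ + δ * 2 := by gcongr
      _ = 6 * δ := by ring
  -- `b` is nearly idempotent, so `g = 2b - 1` is nearly a symmetry. Multiplying it by `S`, the
  -- inverse square root of `g²`, makes it an exact symmetry `g * S`, and `(1 + g * S) / 2` is the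
  -- projection sought.
  set g : B := b + b - 1 with hg
  have hgsa : IsSelfAdjoint g := (hbsa.add hbsa).sub (IsSelfAdjoint.one B)
  have hgg : g * g - 1 = (4 : ℝ) • (b * b - b) := by
    have : (4 : ℝ) • (b * b - b) = (b * b - b) + (b * b - b) + (b * b - b) + (b * b - b) := by
      rw [show (4 : ℝ) = 1 + 1 + 1 + 1 by norm_num]
      simp only [add_smul, one_smul]
    rw [this, hg]; noncomm_ring
  have hggn : ‖g * g - 1‖ ≤ 24 * δ := by
    rw [hgg, norm_smul, Real.norm_of_nonneg (by norm_num)]; linarith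
  have hGsa : IsSelfAdjoint (g * g) := by
    have := IsSelfAdjoint.star_mul_self g
    rwa [hgsa.star_eq] at this
  obtain ⟨S, hS, hcomm, hSGS, hSn⟩ := exists_inv_sqrt hGsa
    (spectrum_pos_of_norm_sub_one_lt hGsa (by linarith))
  have hSn := (hSn (by linarith)).trans hggn
  have hSg : S * g = g * S := (hcomm g (by simp [Commute, SemiconjBy, mul_assoc])).eq
  have hss : (g * S) * (g * S) = 1 := by
    rw [← hSGS]
    nth_rw 1 [← hSg]
    noncomm_ring
  have hssa : star (g * S) = g * S := by rw [star_mul, hS.star_eq, hgsa.star_eq, hSg]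
  have hg9 : ‖g * (S - 1)‖ ≤ 9 * (24 * δ) := by
    have hg' : ‖g‖ ≤ 9 := by
      have h1 : ‖(1 : B)‖ ≤ 1 := norm_le_one_of_projection (IsSelfAdjoint.one B) (one_mul 1)
      calc ‖g‖ ≤ ‖b + b‖ + ‖(1 : B)‖ := norm_sub_le _ _
        _ ≤ ‖b‖ + ‖b‖ + 1 := add_le_add (norm_add_le _ _) h1
        _ ≤ 9 := by linarith
    exact (norm_mul_le _ _).trans (mul_le_mul hg' hSn (norm_nonneg _) (by norm_num))
  refine ⟨(1 / 2 : ℝ) • (1 + g * S), ?_, ?_, ?_⟩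
  · rw [IsSelfAdjoint, star_smul, star_add, star_one, hssa]; simp
  · have : (1 + g * S) * (1 + g * S) = (2 : ℝ) • (1 + g * S) := by
      rw [mul_add, add_mul, add_mul, hss, two_smul]
      simp only [one_mul, mul_one]
      abel
    rw [smul_mul_smul_comm, this, smul_smul]
    norm_num
  · calc ‖(1 / 2 : ℝ) • (1 + g * S) - a‖ = ‖(1 / 2 : ℝ) • (g * (S - 1)) + (b - a)‖ := by
          congr 1
          have : b = (1 / 2 : ℝ) • (g + 1) := by
            rw [hg, sub_add_cancel, ← two_smul ℝ b, smul_smul]; norm_num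
          rw [this, ← add_sub_assoc, ← smul_add]
          congr 2
          noncomm_ring
      _ ≤ ‖(1 / 2 : ℝ) • (g * (S - 1))‖ + ‖b - a‖ := norm_add_le _ _
      _ ≤ 1 / 2 * (9 * (24 * δ)) + δ := by
          rw [norm_smul, Real.norm_of_nonneg (by norm_num)]; gcongr
      _ = 109 * δ := by ring

end Perturbation

/-! ### Matrix units and their first column -/

section MatrixUnits

variable {n : Type*} [Fintype n] [DecidableEq n] {B : Type v} [CStarAlgebra B]

/-- The unital *-homomorphism defined by the first column of a system of matrix units. -/
theorem exists_starAlgHom_of_column {u : n → B} {p : B}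
    (hu : ∀ i j, star (u i) * u j = if i = j then p else 0) (hup : ∀ i, u i * p = u i)
    (h1 : ∑ i, u i * star (u i) = 1) :
    ∃ ψ : Matrix n n ℂ →⋆ₐ[ℂ] B, ∀ c, ψ c = ∑ a, ∑ b, c a b • (u a * star (u b)) := by
  let L : Matrix n n ℂ →ₗ[ℂ] B :=
    { toFun := fun c => ∑ a, ∑ b, c a b • (u a * star (u b))
      map_add' := fun c d => by
        simp only [Matrix.add_apply, add_smul, Finset.sum_add_distrib]
      map_smul' := fun r c => by
        simp only [Matrix.smul_apply, smul_eq_mul, mul_smul, Finset.smul_sum, RingHom.id_apply] }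
  have hL : ∀ c, L c = ∑ a, ∑ b, c a b • (u a * star (u b)) := fun c => rfl
  have hmul : ∀ a b c d, (u a * star (u b)) * (u c * star (u d)) =
      if b = c then u a * star (u d) else 0 := by
    intro a b c d
    calc (u a * star (u b)) * (u c * star (u d)) = u a * (star (u b) * u c) * star (u d) := by
          noncomm_ring
      _ = _ := by
          rw [hu]
          split_ifs
          · rw [hup]
          · simp
  have hone : L 1 = 1 := by
    rw [hL, ← h1]
    refine Finset.sum_congr rfl fun a _ => ?_
    simp [Matrix.one_apply]
  have hmulL : ∀ c d, L (c * d) = L c * L d := by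
    intro c d
    have hinner : ∀ a b, (c a b • (u a * star (u b))) * L d =
        ∑ f, (c a b * d b f) • (u a * star (u f)) := by
      intro a b
      rw [hL, Finset.mul_sum, Finset.sum_eq_single b]
      · simp only [Finset.mul_sum, smul_mul_smul_comm, hmul, if_true]
      · intro e _ he
        simp only [Finset.mul_sum, smul_mul_smul_comm, hmul, if_neg he.symm, smul_zero,
          Finset.sum_const_zero]
      · simp
    rw [hL c, Finset.sum_mul, hL]
    refine Finset.sum_congr rfl fun a _ => ?_
    simp only [Finset.sum_mul, hinner, Matrix.mul_apply, Finset.sum_smul]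
    exact Finset.sum_comm
  have hstar : ∀ c, L (star c) = star (L c) := by
    intro c
    simp only [hL, star_sum, star_smul, star_mul, star_star, Matrix.star_apply]
    exact Finset.sum_comm
  exact ⟨{ AlgHom.ofLinearMap L hone hmulL with map_star' := hstar }, hL⟩

variable (ψ : Matrix n n ℂ →⋆ₐ[ℂ] B) (o : n)

theorem star_map_single_mul (i j : n) :
    star (ψ (Matrix.single i o 1)) * ψ (Matrix.single j o 1) =
      if i = j then ψ (Matrix.single o o 1) else 0 := by
  rw [← map_star, ← map_mul, Matrix.star_eq_conjTranspose, Matrix.conjTranspose_single, star_one]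
  split_ifs with h
  · subst h; simp
  · rw [Matrix.single_mul_single_of_ne _ _ _ _ h, map_zero]

theorem map_single_mul_star (i j : n) :
    ψ (Matrix.single i o 1) * star (ψ (Matrix.single j o 1)) = ψ (Matrix.single i j 1) := by
  rw [← map_star, ← map_mul, Matrix.star_eq_conjTranspose, Matrix.conjTranspose_single, star_one]
  simp

theorem sum_map_single_mul_star :
    ∑ i, ψ (Matrix.single i o 1) * star (ψ (Matrix.single i o 1)) = 1 := by
  simp only [map_single_mul_star]
  rw [← map_sum, Matrix.sum_single_one, map_one]

/-- Since `e_ab = e_ao (e_bo)*`, the first column determines the homomorphism. Columns can thus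
replace full systems of matrix units throughout. -/
theorem map_eq_sum_column (c : Matrix n n ℂ) :
    ψ c = ∑ a, ∑ b, c a b • (ψ (Matrix.single a o 1) * star (ψ (Matrix.single b o 1))) := by
  simp only [map_single_mul_star]
  conv_lhs => rw [Matrix.matrix_eq_sum_single c]
  simp only [map_sum]
  refine Finset.sum_congr rfl fun a _ => Finset.sum_congr rfl fun b _ => ?_
  rw [← map_smul, Matrix.smul_single, smul_eq_mul, mul_one]

theorem norm_map_single_le (i j : n) : ‖ψ (Matrix.single i j 1)‖ ≤ 1 := by
  have h := CStarRing.norm_star_mul_self (x := ψ (Matrix.single i j 1))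
  rw [star_map_single_mul, if_pos rfl] at h
  have hp : ‖ψ (Matrix.single j j 1)‖ ≤ 1 := by
    refine norm_le_one_of_projection ?_ ?_
    · rw [IsSelfAdjoint, ← map_star, Matrix.star_eq_conjTranspose, Matrix.conjTranspose_single,
        star_one]
    · rw [← map_mul]; simp
  nlinarith [norm_nonneg (ψ (Matrix.single i j 1))]

end MatrixUnits

/-! ### Weak stability of matrix units -/

section WeakStability

open scoped Topology
open Filter

/-- A crude bound, sufficient because the matrix size is fixed; it causes the powers of
`Fintype.card n` in the later estimates. -/
theorem CStarMatrix.norm_le_sum_norm {n : Type*} [Fintype n] [DecidableEq n] {B : Type v}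
    [CStarAlgebra B] [PartialOrder B] [StarOrderedRing B] (M : CStarMatrix n n B) :
    ‖M‖ ≤ ∑ i, ∑ j, ‖M i j‖ := by
  rw [norm_def]
  refine (toCLM M).opNorm_le_bound (by positivity) fun v => ?_
  rw [Finset.sum_comm]
  simp only [toCLM_apply_eq_sum, Finset.sum_mul]
  refine (WithCStarModule.pi_norm_le_sum_norm _).trans ?_
  gcongr with i _
  refine (norm_sum_le _ _).trans ?_
  gcongr with j _
  refine (norm_mul_le _ _).trans ?_
  rw [mul_comm]
  gcongr
  exact WithCStarModule.norm_apply_le_norm v j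

variable {n : Type*} [Fintype n] [DecidableEq n]

/-- Orthonormalization: elements `w i` of a C*-algebra with `w i * p = w i` that are almost
orthonormal with respect to a projection `p` are close to orthonormal ones. -/
theorem exists_orthonormal_near {B : Type v} [CStarAlgebra B] {p : B} (hp : IsSelfAdjoint p)
    (hpp : p * p = p) {w : n → B} (hw : ∀ i, w i * p = w i) {η : ℝ}
    (hη : (Fintype.card n) ^ 2 * η ≤ 1 / 2) (hw1 : ∀ i, ‖w i‖ ≤ 2)
    (h : ∀ i j, ‖star (w i) * w j - if i = j then p else 0‖ ≤ η) :
    ∃ u : n → B, (∀ i j, star (u i) * u j = if i = j then p else 0) ∧ (∀ i, u i * p = u i) ∧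
      ∀ i, ‖u i - w i‖ ≤ 2 * Fintype.card n ^ 3 * η := by
  let _ := CStarAlgebra.spectralOrder B
  have := CStarAlgebra.spectralOrderedRing B
  have hwp : ∀ i j, p * (star (w i) * w j) = star (w i) * w j := fun i j => by
    rw [← mul_assoc]; congr 1
    rw [← hp.star_eq, ← star_mul, hw]
  have hwp' : ∀ i j, (star (w i) * w j) * p = star (w i) * w j := fun i j => by
    rw [mul_assoc, hw]
  -- The Gram matrix of `w` lives in the corner of `p`; adding `1 - p` on the diagonal makes it
  -- close to the identity of the full matrix algebra. It commutes with `P = diag(p)`, hence so does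
  -- its inverse square root `S`, and the columns `∑ i, w i * S i j` have Gram matrix `S * G * S * P
  -- = P`.
  let G : CStarMatrix n n B :=
    CStarMatrix.ofMatrix fun i j => star (w i) * w j + if i = j then 1 - p else 0
  let P : CStarMatrix n n B := CStarMatrix.ofMatrix fun i j => if i = j then p else 0
  have hG : ∀ i j, G i j = star (w i) * w j + if i = j then 1 - p else 0 := fun i j => rfl
  have hP : ∀ i j, P i j = if i = j then p else 0 := fun i j => rfl
  have hMP : ∀ (M : CStarMatrix n n B) i j, (M * P) i j = M i j * p := fun M i j => by
    simp [CStarMatrix.mul_apply, hP]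
  have hPM : ∀ (M : CStarMatrix n n B) i j, (P * M) i j = p * M i j := fun M i j => by
    simp [CStarMatrix.mul_apply, hP]
  have hGp : ∀ i j, G i j * p = star (w i) * w j := fun i j => by
    rw [hG, add_mul, hwp']
    split_ifs <;> simp [sub_mul, hpp]
  have hpG : ∀ i j, p * G i j = star (w i) * w j := fun i j => by
    rw [hG, mul_add, hwp]
    split_ifs <;> simp [mul_sub, hpp]
  have hGsa : IsSelfAdjoint G := by
    refine CStarMatrix.ext fun i j => ?_
    rw [CStarMatrix.star_apply, hG, hG, star_add, star_mul, star_star]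
    congr 1
    simp only [eq_comm (a := i)]
    split_ifs
    · rw [star_sub, star_one, hp.star_eq]
    · exact star_zero _
  have hG1 : ‖G - 1‖ ≤ Fintype.card n ^ 2 * η := by
    refine (CStarMatrix.norm_le_sum_norm _).trans ?_
    calc ∑ i, ∑ j, ‖(G - 1) i j‖ ≤ ∑ i : n, ∑ j : n, η := by
          refine Finset.sum_le_sum fun i _ => Finset.sum_le_sum fun j _ => ?_
          refine le_trans (le_of_eq ?_) (h i j)
          rw [CStarMatrix.sub_apply, hG, CStarMatrix.one_apply]
          congr 1
          split_ifs
          · abel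
          · simp
      _ = _ := by simp; ring
  obtain ⟨S, hS, hcomm, hSGS, hS1⟩ :=
    exists_inv_sqrt hGsa (spectrum_pos_of_norm_sub_one_lt hGsa (by linarith))
  have hS1 := (hS1 (hG1.trans hη)).trans hG1
  have hSP : S * P = P * S := hcomm P (CStarMatrix.ext fun i j => by rw [hMP, hPM, hGp, hpG])
  have hSp : ∀ i j, S i j * p = p * S i j := fun i j => by rw [← hMP, hSP, hPM]
  have hSs : ∀ i j, star (S i j) = S j i := fun i j => by
    conv_rhs => rw [← hS.star_eq]
    rfl
  refine ⟨fun j => ∑ i, w i * S i j, fun i j => ?_, fun j => ?_, fun j => ?_⟩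
  · have h1 : (S * G * S * P) i j = if i = j then p else 0 := by rw [hSGS, one_mul, hP]
    rw [← h1, mul_assoc, hSP, ← mul_assoc, mul_assoc S]
    rw [CStarMatrix.mul_apply]
    simp only [CStarMatrix.mul_apply, hMP, hGp, star_sum, Finset.sum_mul, Finset.mul_sum,
      star_mul, hSs]
    refine Finset.sum_congr rfl fun a _ => Finset.sum_congr rfl fun b _ => ?_
    simp only [mul_assoc]
  · simp only [Finset.sum_mul, mul_assoc, hSp]
    simp only [← mul_assoc, hw]
  · have h1 : ∑ i, w i * S i j - w j = ∑ i, w i * (S - 1) i j := by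
      simp [CStarMatrix.sub_apply, mul_sub, Finset.sum_sub_distrib, CStarMatrix.one_apply]
    change ‖∑ i, w i * S i j - w j‖ ≤ _
    rw [h1]
    calc ‖∑ i, w i * (S - 1) i j‖ ≤ ∑ i : n, 2 * (Fintype.card n ^ 2 * η) := by
          refine norm_sum_le_of_le _ fun i _ => (norm_mul_le _ _).trans ?_
          exact mul_le_mul (hw1 i) (CStarMatrix.norm_entry_le_norm.trans hS1) (norm_nonneg _)
            (by norm_num)
      _ = _ := by simp; ring

theorem norm_mul_star_sub_le {B : Type v} [CStarAlgebra B] {a b c d : B} {ε : ℝ}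
    (ha : ‖a‖ ≤ 2) (hd : ‖d‖ ≤ 2) (hac : ‖a - c‖ ≤ ε) (hbd : ‖b - d‖ ≤ ε) :
    ‖a * star b - c * star d‖ ≤ 4 * ε := by
  calc ‖a * star b - c * star d‖ = ‖a * star (b - d) + (a - c) * star d‖ := by
        rw [star_sub]; congr 1; noncomm_ring
    _ ≤ ‖a‖ * ‖b - d‖ + ‖a - c‖ * ‖d‖ := by
        refine (norm_add_le _ _).trans (add_le_add ?_ ?_)
        · rw [← norm_star (b - d)]; exact norm_mul_le _ _
        · rw [← norm_star d]; exact norm_mul_le _ _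
    _ ≤ 2 * ε + ε * 2 := by
        have : 0 ≤ ε := (norm_nonneg _).trans hac
        gcongr
    _ = 4 * ε := by ring

/-- Quantitative weak stability of matrix units. -/
theorem exists_starAlgHom_near_of_le {B : Type v} [CStarAlgebra B] (o : n) {v : n → B} {δ τ : ℝ}
    (hδ : δ ≤ 1 / 48) (hδ1 : (Fintype.card n) ^ 2 * (110 * δ) ≤ 1 / 2)
    (hτ : √(110 * δ) + 2 * Fintype.card n ^ 3 * (110 * δ) + 109 * δ ≤ τ)
    (hτ1 : δ + Fintype.card n * (4 * τ) < 1)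
    (h : ∀ i j, ‖star (v i) * v j - if i = j then v o else 0‖ ≤ δ)
    (h1 : ‖∑ i, v i * star (v i) - 1‖ ≤ δ) :
    ∃ ψ : Matrix n n ℂ →⋆ₐ[ℂ] B, ∀ i, ‖ψ (Matrix.single i o 1) - v i‖ ≤ 4 * τ := by
  have hδ0 : 0 ≤ δ := (norm_nonneg _).trans h1
  have hoo : ‖star (v o) * v o - v o‖ ≤ δ := by simpa using h o o
  obtain ⟨p, hp, hpp, hpv⟩ := exists_projection_near hδ hoo
  have hp1 := norm_le_one_of_projection hp hpp
  have hq : IsSelfAdjoint (1 - p) := (IsSelfAdjoint.one B).sub hp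
  have hqq : (1 - p) * (1 - p) = 1 - p := by simp [mul_sub, sub_mul, hpp]
  have hq1 := norm_le_one_of_projection hq hqq
  have hvp : ∀ i j, ‖star (v i) * v j - if i = j then p else 0‖ ≤ 110 * δ := fun i j => by
    have e := h i j
    split_ifs with hij
    · rw [if_pos hij] at e
      calc ‖star (v i) * v j - p‖ = ‖(star (v i) * v j - v o) - (p - v o)‖ := by congr 1; abel
        _ ≤ δ + 109 * δ := (norm_sub_le _ _).trans (add_le_add e hpv)
        _ = 110 * δ := by ring
    · rw [if_neg hij] at e
      linarith
  have hv2 : ∀ i, ‖v i‖ ≤ 2 := fun i => by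
    have e := hvp i i
    rw [if_pos rfl] at e
    have e2 : ‖star (v i) * v i‖ ≤ ‖p‖ + 110 * δ := by
      have := norm_sub_norm_le (star (v i) * v i) p
      linarith
    rw [CStarRing.norm_star_mul_self] at e2
    nlinarith [norm_nonneg (v i)]
  -- The square root comes from the C*-identity: `‖v i * (1 - p)‖²` is the norm of the compression
  -- of `v i* v i - p` by `1 - p`.
  have hvq : ∀ i, ‖v i * p - v i‖ ≤ √(110 * δ) := fun i => by
    refine Real.le_sqrt_of_sq_le ?_
    have e := hvp i i
    rw [if_pos rfl] at e
    have : star (v i * p - v i) * (v i * p - v i) =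
        (1 - p) * (star (v i) * v i - p) * (1 - p) := by
      have h2 : (1 - p) * p = 0 := by rw [sub_mul, hpp]; simp
      have h3 : v i * p - v i = -(v i * (1 - p)) := by noncomm_ring
      rw [h3, star_neg, star_mul, hq.star_eq, mul_sub (1 - p), h2]
      noncomm_ring
    rw [sq, ← CStarRing.norm_star_mul_self, this]
    calc ‖(1 - p) * (star (v i) * v i - p) * (1 - p)‖
        ≤ ‖1 - p‖ * ‖star (v i) * v i - p‖ * ‖1 - p‖ :=
          (norm_mul_le _ _).trans (mul_le_mul_of_nonneg_right (norm_mul_le _ _) (norm_nonneg _))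
      _ ≤ 1 * (110 * δ) * 1 := by gcongr
      _ = 110 * δ := by ring
  have hw : ∀ i j, ‖star (v i * p) * (v j * p) - if i = j then p else 0‖ ≤ 110 * δ :=
    fun i j => by
    have : star (v i * p) * (v j * p) - (if i = j then p else 0) =
        p * (star (v i) * v j - if i = j then p else 0) * p := by
      rw [star_mul, hp.star_eq, mul_sub, sub_mul]
      congr 1
      · noncomm_ring
      · split_ifs <;> simp [hpp]
    rw [this]
    calc ‖p * (star (v i) * v j - if i = j then p else 0) * p‖
        ≤ ‖p‖ * ‖star (v i) * v j - if i = j then p else 0‖ * ‖p‖ :=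
          (norm_mul_le _ _).trans (mul_le_mul_of_nonneg_right (norm_mul_le _ _) (norm_nonneg _))
      _ ≤ 1 * (110 * δ) * 1 := by gcongr; exact hvp i j
      _ = 110 * δ := by ring
  obtain ⟨u, hu, hup, huw⟩ := exists_orthonormal_near hp hpp (w := fun i => v i * p)
    (fun i => by rw [mul_assoc, hpp]) hδ1
    (fun i => (norm_mul_le _ _).trans
      ((mul_le_mul (hv2 i) hp1 (norm_nonneg _) (by norm_num)).trans (by norm_num))) hw
  have huv : ∀ i, ‖u i - v i‖ ≤ τ := fun i => by
    calc ‖u i - v i‖ = ‖(u i - v i * p) + (v i * p - v i)‖ := by congr 1; abel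
      _ ≤ 2 * Fintype.card n ^ 3 * (110 * δ) + √(110 * δ) :=
        (norm_add_le _ _).trans (add_le_add (huw i) (hvq i))
      _ ≤ τ := by linarith
  have hup1 : ‖u o - p‖ ≤ τ := by
    calc ‖u o - p‖ = ‖(u o - v o * p) + (v o * p - v o) - (p - v o)‖ := by congr 1; abel
      _ ≤ 2 * Fintype.card n ^ 3 * (110 * δ) + √(110 * δ) + 109 * δ :=
        (norm_sub_le _ _).trans
          (add_le_add ((norm_add_le _ _).trans (add_le_add (huw o) (hvq o))) hpv)
      _ ≤ τ := by linarith
  have hu1 : ∀ i, ‖u i‖ ≤ 1 := fun i => by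
    have e : star (u i) * u i = p := by rw [hu, if_pos rfl]
    have e2 := CStarRing.norm_star_mul_self (x := u i)
    rw [e] at e2
    nlinarith [norm_nonneg (u i)]
  have hsum : ∑ i, u i * star (u i) = 1 := by
    -- The defect of the unit is an idempotent of norm less than 1, so it vanishes exactly.
    have hidem : IsIdempotentElem (1 - ∑ i, u i * star (u i)) := by
      refine IsIdempotentElem.one_sub ?_
      rw [IsIdempotentElem, Finset.sum_mul_sum]
      refine Finset.sum_congr rfl fun i _ => ?_
      rw [Finset.sum_eq_single i]
      · calc u i * star (u i) * (u i * star (u i)) = u i * (star (u i) * u i) * star (u i) := by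
              noncomm_ring
          _ = _ := by rw [hu, if_pos rfl, hup]
      · intro j _ hj
        calc u i * star (u i) * (u j * star (u j)) = u i * (star (u i) * u j) * star (u j) := by
              noncomm_ring
          _ = 0 := by rw [hu, if_neg hj.symm]; simp
      · simp
    refine (sub_eq_zero.1 (eq_zero_of_isIdempotentElem_of_norm_lt hidem ?_)).symm
    calc ‖1 - ∑ i, u i * star (u i)‖
        = ‖(∑ i, v i * star (v i) - 1) + ∑ i, (u i * star (u i) - v i * star (v i))‖ := by
          rw [← norm_neg, Finset.sum_sub_distrib]; congr 1; abel
      _ ≤ δ + ∑ i : n, 4 * τ := by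
          refine (norm_add_le _ _).trans (add_le_add h1 (norm_sum_le_of_le _ fun i _ => ?_))
          exact norm_mul_star_sub_le ((hu1 i).trans (by norm_num)) (hv2 i) (huv i) (huv i)
      _ = δ + Fintype.card n * (4 * τ) := by simp
      _ < 1 := hτ1
  obtain ⟨ψ, hψ⟩ := exists_starAlgHom_of_column hu hup hsum
  refine ⟨ψ, fun i => ?_⟩
  -- The column of `ψ` is `u i * (u o)*` rather than `u i`; the two are close because `u o` is close
  -- to `p`.
  have e : ψ (Matrix.single i o 1) = u i * star (u o) := by
    rw [hψ, Finset.sum_eq_single i, Finset.sum_eq_single o]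
    · simp
    · intro b _ hb
      simp [hb.symm]
    · simp
    · intro a _ ha
      simp [ha.symm]
    · simp
  rw [e]
  calc ‖u i * star (u o) - v i‖ = ‖u i * (star (u o) - p) + (u i - v i)‖ := by
        rw [mul_sub, hup]; congr 1; abel
    _ ≤ 1 * τ + τ := by
        refine (norm_add_le _ _).trans (add_le_add ((norm_mul_le _ _).trans ?_) (huv i))
        refine mul_le_mul (hu1 i) ?_ (norm_nonneg _) zero_le_one
        rw [← hp.star_eq, ← star_sub, norm_star]
        exact hup1
    _ ≤ 4 * τ := by
        have : 0 ≤ τ := (norm_nonneg _).trans hup1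
        linarith

/-- Weak stability of matrix units: approximate (first columns of) systems of matrix units are
close to those given by unital *-homomorphisms, uniformly over all unital C*-algebras. -/
theorem exists_starAlgHom_near (o : n) {ε : ℝ} (hε : 0 < ε) :
    ∃ δ > 0, ∀ (B : Type v) [CStarAlgebra B] (v : n → B),
      (∀ i j, ‖star (v i) * v j - if i = j then v o else 0‖ ≤ δ) →
      ‖∑ i, v i * star (v i) - 1‖ ≤ δ →
      ∃ ψ : Matrix n n ℂ →⋆ₐ[ℂ] B, ∀ i, ‖ψ (Matrix.single i o 1) - v i‖ ≤ ε := by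
  have key : ∀ f : ℝ → ℝ, Continuous f → f 0 = 0 → ∀ c > 0, ∀ᶠ δ in 𝓝[>] (0 : ℝ), f δ < c := by
    intro f hf h0 c hc
    have := (hf.tendsto 0).mono_left (nhdsWithin_le_nhds (s := Set.Ioi 0))
    rw [h0] at this
    exact this.eventually_lt_const hc
  let τ : ℝ → ℝ := fun δ => √(110 * δ) + 2 * Fintype.card n ^ 3 * (110 * δ) + 109 * δ
  have hτc : Continuous τ := by fun_prop
  have hτ0 : τ 0 = 0 := by simp [τ]
  obtain ⟨δ, hδ, h1, h2, h3, h4⟩ :=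
    ((eventually_mem_nhdsWithin (a := (0 : ℝ)) (s := Set.Ioi 0)).and ((key (fun δ => δ) (by fun_prop) rfl (1 / 48) (by norm_num)).and
      ((key (fun δ => (Fintype.card n) ^ 2 * (110 * δ)) (by fun_prop) (by simp) (1 / 2)
        (by norm_num)).and ((key (fun δ => δ + Fintype.card n * (4 * τ δ)) (by fun_prop)
        (by simp [hτ0]) 1 one_pos).and
        (key (fun δ => 4 * τ δ) (by fun_prop) (by simp [hτ0]) ε hε))))).exists
  refine ⟨δ, hδ, fun B _ v hv hv1 => ?_⟩
  obtain ⟨ψ, hψ⟩ := exists_starAlgHom_near_of_le o h1.le h2.le (le_refl (τ δ)) h3 hv hv1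
  exact ⟨ψ, fun i => (hψ i).trans h4.le⟩

end WeakStability

/-! ### Intertwiners and unitary conjugacy -/

section Intertwiner

variable {n : Type*} [Fintype n] [DecidableEq n]

section Ring

variable {D : Type*} [Ring D] [StarRing D] [Algebra ℂ D] (φ ψ : Matrix n n ℂ →⋆ₐ[ℂ] D) (o : n)

/-- Averaging any `a` over matrix units yields an intertwiner: for `x = e_ij` a single term survives
on each side, and both equal `ψ(e_io) a φ(e_oj)`. -/
theorem sum_intertwines (a : D) (x : Matrix n n ℂ) :
    (∑ i, ψ (Matrix.single i o 1) * a * φ (Matrix.single o i 1)) * φ x =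
      ψ x * ∑ i, ψ (Matrix.single i o 1) * a * φ (Matrix.single o i 1) := by
  induction x using Matrix.induction_on' with
  | h_zero => simp
  | h_add x y hx hy => rw [map_add, map_add, mul_add, add_mul, hx, hy]
  | h_std_basis i j c =>
    have hs : Matrix.single i j c = c • Matrix.single i j (1 : ℂ) := by simp
    rw [hs, map_smul, map_smul, mul_smul_comm, smul_mul_assoc]
    congr 1
    rw [Finset.sum_mul, Finset.mul_sum, Finset.sum_eq_single i, Finset.sum_eq_single j]
    · rw [mul_assoc, ← map_mul, ← mul_assoc, ← mul_assoc, ← map_mul]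
      simp
    · intro l _ hl
      rw [← mul_assoc, ← mul_assoc, ← map_mul, Matrix.single_mul_single_of_ne _ _ _ _ hl.symm]
      simp
    · simp
    · intro l _ hl
      rw [mul_assoc, ← map_mul, Matrix.single_mul_single_of_ne _ _ _ _ hl]
      simp
    · simp

/-- Only a one-sided inverse is obtained, which is enough for invertibility in a full matrix
algebra. -/
theorem sum_mul_sum_eq_one {a b : D}
    (h : b * ψ (Matrix.single o o 1) * a = φ (Matrix.single o o 1)) :
    (∑ i, φ (Matrix.single i o 1) * b * ψ (Matrix.single o i 1)) *
      ∑ i, ψ (Matrix.single i o 1) * a * φ (Matrix.single o i 1) = 1 := by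
  rw [Finset.sum_mul_sum, ← map_one φ, ← Matrix.sum_single_one, map_sum]
  refine Finset.sum_congr rfl fun i _ => ?_
  rw [Finset.sum_eq_single i]
  · calc φ (Matrix.single i o 1) * b * ψ (Matrix.single o i 1) *
          (ψ (Matrix.single i o 1) * a * φ (Matrix.single o i 1))
        = φ (Matrix.single i o 1) *
          (b * (ψ (Matrix.single o i 1) * ψ (Matrix.single i o 1)) * a) *
          φ (Matrix.single o i 1) := by noncomm_ring
      _ = φ (Matrix.single i i 1) := by
        rw [← map_mul, Matrix.single_mul_single_same, one_mul, h, ← map_mul, ← map_mul]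
        simp
  · intro j _ hj
    calc φ (Matrix.single i o 1) * b * ψ (Matrix.single o i 1) *
          (ψ (Matrix.single j o 1) * a * φ (Matrix.single o j 1))
        = φ (Matrix.single i o 1) *
          (b * (ψ (Matrix.single o i 1) * ψ (Matrix.single j o 1)) * a) *
          φ (Matrix.single o j 1) := by noncomm_ring
      _ = 0 := by
        rw [← map_mul, Matrix.single_mul_single_of_ne _ _ _ _ hj.symm]
        simp
  · simp

end Ring

/-- Idempotent matrices with the same trace are Murray-von Neumann equivalent. -/
theorem Matrix.exists_mul_mul_eq_of_trace_eq {m : Type*} [Fintype m] [DecidableEq m]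
    {p q : Matrix m m ℂ} (hp : IsIdempotentElem p) (hq : IsIdempotentElem q)
    (h : p.trace = q.trace) : ∃ a b : Matrix m m ℂ, b * q * a = p := by
  let P := Matrix.toLin' p
  let Q := Matrix.toLin' q
  have hP : LinearMap.IsProj (LinearMap.range P) P :=
    LinearMap.isProj_range_iff_isIdempotentElem _ |>.2 (hp.map (Matrix.toLinAlgEquiv' (R := ℂ)))
  have hQ : LinearMap.IsProj (LinearMap.range Q) Q :=
    LinearMap.isProj_range_iff_isIdempotentElem _ |>.2 (hq.map (Matrix.toLinAlgEquiv' (R := ℂ)))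
  -- The trace of an idempotent is its rank, and ℂ has characteristic zero.
  have hr : Module.finrank ℂ (LinearMap.range P) = Module.finrank ℂ (LinearMap.range Q) := by
    have h1 := hP.trace
    have h2 := hQ.trace
    rw [Matrix.trace_toLin'_eq] at h1 h2
    rw [h1, h2] at h
    exact_mod_cast h
  let e := LinearEquiv.ofFinrankEq _ _ hr
  refine ⟨LinearMap.toMatrix' ((LinearMap.range Q).subtype ∘ₗ e.toLinearMap ∘ₗ P.rangeRestrict),
    LinearMap.toMatrix' ((LinearMap.range P).subtype ∘ₗ e.symm.toLinearMap ∘ₗ Q.rangeRestrict),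
    ?_⟩
  apply Matrix.toLin'.injective
  rw [Matrix.toLin'_mul, Matrix.toLin'_mul, Matrix.toLin'_toMatrix', Matrix.toLin'_toMatrix']
  refine LinearMap.ext fun x => ?_
  have hfix : ∀ y : LinearMap.range Q, Q.rangeRestrict y = y := fun y =>
    Subtype.ext (hQ.map_id y y.2)
  change ((e.symm (Q.rangeRestrict (Q (e (P.rangeRestrict x))))) : m → ℂ) = P x
  have h3 : Q (e (P.rangeRestrict x)) = e (P.rangeRestrict x) := hQ.map_id _ (e _).2
  rw [h3, hfix, LinearEquiv.symm_apply_apply]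
  rfl

/-- The diagonal matrix units have images of equal trace and sum to 1. The trace of each is
therefore independent of the homomorphism. -/
theorem card_mul_trace_eq {m : Type*} [Fintype m] [DecidableEq m]
    (φ : Matrix n n ℂ →⋆ₐ[ℂ] Matrix m m ℂ) (o : n) :
    (Fintype.card n : ℂ) * (φ (Matrix.single o o 1)).trace = Fintype.card m := by
  have h : ∀ i, (φ (Matrix.single i i 1)).trace = (φ (Matrix.single o o 1)).trace := fun i => by
    have h1 : Matrix.single i i (1 : ℂ) = Matrix.single i o 1 * Matrix.single o i 1 := by simp
    have h2 : Matrix.single o o (1 : ℂ) = Matrix.single o i 1 * Matrix.single i o 1 := by simp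
    rw [h1, h2, map_mul, map_mul, Matrix.trace_mul_comm]
  have h1 : (Fintype.card m : ℂ) = (φ 1).trace := by rw [map_one, Matrix.trace_one]
  rw [h1, ← Matrix.sum_single_one, map_sum, Matrix.trace_sum]
  simp [h]

/-- Unital *-homomorphisms between full matrix algebras are intertwined by an invertible
matrix. -/
theorem exists_isUnit_intertwines {m : Type*} [Fintype m] [DecidableEq m]
    (φ ψ : Matrix n n ℂ →⋆ₐ[ℂ] Matrix m m ℂ) (o : n) :
    ∃ s, IsUnit s ∧ ∀ x, s * φ x = ψ x * s := by
  have hidem : ∀ χ : Matrix n n ℂ →⋆ₐ[ℂ] Matrix m m ℂ,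
      IsIdempotentElem (χ (Matrix.single o o 1)) := fun χ => by
    rw [IsIdempotentElem, ← map_mul]; simp
  have hn : (Fintype.card n : ℂ) ≠ 0 := by
    have : Nonempty n := ⟨o⟩
    exact_mod_cast Fintype.card_ne_zero
  obtain ⟨a, b, hab⟩ := Matrix.exists_mul_mul_eq_of_trace_eq (hidem φ) (hidem ψ)
    (mul_left_cancel₀ hn ((card_mul_trace_eq φ o).trans (card_mul_trace_eq ψ o).symm))
  exact ⟨_, IsUnit.of_mul_eq_one_right _ (sum_mul_sum_eq_one φ ψ o hab), sum_intertwines φ ψ o a⟩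

/-- Close unital *-homomorphisms from a matrix algebra are unitarily conjugate. -/
theorem exists_unitary_of_near {B : Type v} [CStarAlgebra B] (φ ψ : Matrix n n ℂ →⋆ₐ[ℂ] B) (o : n)
    {ε : ℝ} (hε : Fintype.card n * ε < 1)
    (h : ∀ i, ‖ψ (Matrix.single i o 1) - φ (Matrix.single i o 1)‖ ≤ ε) :
    ∃ w : unitary B, ∀ x, ψ x = (w : B) * φ x * star (w : B) := by
  refine exists_unitary_of_isUnit φ ψ
    (s := ∑ i, ψ (Matrix.single i o 1) * 1 * φ (Matrix.single o i 1)) ?_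
    (sum_intertwines φ ψ o 1)
  -- With `a = 1` the averaged intertwiner is within `card n * ε < 1` of the unit, hence invertible.
  have h1 : 1 - ∑ i, ψ (Matrix.single i o 1) * 1 * φ (Matrix.single o i 1) =
      ∑ i, (φ (Matrix.single i o 1) - ψ (Matrix.single i o 1)) * φ (Matrix.single o i 1) := by
    have h0 : (1 : B) = ∑ i, φ (Matrix.single i i 1) := by
      rw [← map_sum, Matrix.sum_single_one, map_one]
    nth_rw 1 [h0]
    rw [← Finset.sum_sub_distrib]
    refine Finset.sum_congr rfl fun i _ => ?_
    rw [mul_one, sub_mul, ← map_mul]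
    simp
  have h2 : ‖1 - ∑ i, ψ (Matrix.single i o 1) * 1 * φ (Matrix.single o i 1)‖ < 1 := by
    rw [h1]
    calc _ ≤ ∑ i : n, ε := by
          refine norm_sum_le_of_le _ fun i _ => (norm_mul_le _ _).trans ?_
          rw [norm_sub_rev]
          have h3 := norm_map_single_le φ o i
          have h4 := h i
          nlinarith [norm_nonneg (φ (Matrix.single o i 1)),
            norm_nonneg (ψ (Matrix.single i o 1) - φ (Matrix.single i o 1))]
      _ = Fintype.card n * ε := by simp
      _ < 1 := hε
  have := (Units.oneSub _ h2).isUnit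
  rwa [Units.val_oneSub, sub_sub_cancel] at this

end Intertwiner

/-! ### Unital copies of matrix algebras in a UHF algebra -/

section UHF

open scoped Topology ComplexOrder
open Filter

variable {A : Type u} [CStarAlgebra A]

/-- Full matrix algebras are C*-algebras for a suitable norm. -/
theorem exists_cstarAlgebra_matrix (m : ℕ) : ∃ (C : Type) (_ : CStarAlgebra C)
    (E : Matrix (Fin m) (Fin m) ℂ →⋆ₐ[ℂ] C) (F : C →⋆ₐ[ℂ] Matrix (Fin m) (Fin m) ℂ),
    (∀ x, F (E x) = x) ∧ ∀ y, E (F y) = y := by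
  let E := CStarMatrix.ofMatrixStarAlgEquiv (n := Fin m) (A := ℂ)
  exact ⟨CStarMatrix (Fin m) (Fin m) ℂ, inferInstance, E.toStarAlgHom, E.symm.toStarAlgHom,
    fun x => E.symm_apply_apply x, fun y => E.apply_symm_apply y⟩

variable {k : ℕ → ℕ} {φ : ∀ n, Matrix (Fin (k n)) (Fin (k n)) ℂ →⋆ₐ[ℂ] A}

theorem exists_approx_of_dense (hmono : Monotone fun n => Set.range (φ n))
    (hdense : Dense (⋃ n, Set.range (φ n))) {m : Type*} [Finite m] (a : m → A) {ε : ℝ}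
    (hε : 0 < ε) : ∃ N, ∀ n ≥ N, ∃ c : m → Matrix (Fin (k n)) (Fin (k n)) ℂ,
      ∀ i, ‖φ n (c i) - a i‖ < ε := by
  have h : ∀ i, ∃ N x, x ∈ Set.range (φ N) ∧ ‖x - a i‖ < ε := fun i => by
    obtain ⟨x, hx, hxa⟩ := Metric.dense_iff.1 hdense (a i) ε hε
    obtain ⟨N, hN⟩ := Set.mem_iUnion.1 hxa
    exact ⟨N, x, hN, by rwa [← dist_eq_norm]⟩
  choose N x hx hxa using h
  cases nonempty_fintype m
  refine ⟨Finset.univ.sup N, fun n hn => ?_⟩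
  have h2 : ∀ i, x i ∈ Set.range (φ n) := fun i =>
    hmono ((Finset.le_sup (Finset.mem_univ i)).trans hn) (hx i)
  choose c hc using h2
  exact ⟨c, fun i => by rw [hc]; exact hxa i⟩

/-- A unital *-homomorphism from a matrix algebra to a UHF algebra is approximated by ones into
the matrix algebras of the defining sequence. -/
theorem exists_factor_near (hinj : ∀ n, Function.Injective (φ n))
    (hmono : Monotone fun n => Set.range (φ n)) (hdense : Dense (⋃ n, Set.range (φ n)))
    {n : Type*} [Fintype n] [DecidableEq n] (o : n) (ψ : Matrix n n ℂ →⋆ₐ[ℂ] A) {ε : ℝ}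
    (hε : 0 < ε) : ∃ N, ∀ l ≥ N, ∃ χ : Matrix n n ℂ →⋆ₐ[ℂ] Matrix (Fin (k l)) (Fin (k l)) ℂ,
      ∀ i, ‖φ l (χ (Matrix.single i o 1)) - ψ (Matrix.single i o 1)‖ ≤ ε := by
  obtain ⟨δ, hδ, H⟩ := exists_starAlgHom_near.{0} (n := n) o (half_pos hε)
  let e : n → A := fun i => ψ (Matrix.single i o 1)
  have h1 : ∀ᶠ v in 𝓝 e, ∀ i j, ‖star (v i) * v j - if i = j then v o else 0‖ < δ := by
    refine eventually_all.2 fun i => eventually_all.2 fun j => ?_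
    have hc : Continuous fun v : n → A => ‖star (v i) * v j - if i = j then v o else 0‖ := by
      split_ifs <;> fun_prop
    refine (hc.tendsto e).eventually_lt_const ?_
    simpa only [e, star_map_single_mul, sub_self, norm_zero] using hδ
  have h2 : ∀ᶠ v in 𝓝 e, ‖∑ i, v i * star (v i) - 1‖ < δ := by
    have hc : Continuous fun v : n → A => ‖∑ i, v i * star (v i) - 1‖ := by fun_prop
    refine (hc.tendsto e).eventually_lt_const ?_
    simpa only [e, sum_map_single_mul_star, sub_self, norm_zero] using hδ
  obtain ⟨η, hη, hball⟩ := Metric.eventually_nhds_iff.1 (h1.and h2)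
  obtain ⟨N, hN⟩ := exists_approx_of_dense hmono hdense e (lt_min hη (half_pos hε))
  refine ⟨N, fun l hl => ?_⟩
  obtain ⟨c, hc⟩ := hN l hl
  obtain ⟨hv1, hv2⟩ := hball (y := fun i => φ l (c i)) (by
    rw [dist_pi_lt_iff hη]
    exact fun i => by rw [dist_eq_norm]; exact (hc i).trans_le (min_le_left _ _))
  -- Weak stability is applied inside the matrix algebra and not in `A`, so that the exact
  -- homomorphism lands there. The estimates carry over because injective *-homomorphisms are
  -- isometric.
  obtain ⟨C, _, E, F, hFE, hEF⟩ := exists_cstarAlgebra_matrix (k l)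
  have hE : ∀ x, ‖φ l x‖ = ‖E x‖ := fun x => by
    have hinjF : Function.Injective ((φ l).comp F) :=
      (hinj l).comp (Function.LeftInverse.injective hEF)
    rw [← NonUnitalStarAlgHom.norm_map ((φ l).comp F) hinjF (E x), StarAlgHom.comp_apply, hFE]
  obtain ⟨χ, hχ⟩ := H C (fun i => E (c i))
    (fun i j => by
      have h3 := (hv1 i j).le
      have e1 : star (φ l (c i)) * φ l (c j) - (if i = j then φ l (c o) else 0) =
          φ l (star (c i) * c j - if i = j then c o else 0) := by
        split_ifs <;> simp [map_star]
      have e2 : star (E (c i)) * E (c j) - (if i = j then E (c o) else 0) =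
          E (star (c i) * c j - if i = j then c o else 0) := by
        split_ifs <;> simp [map_star]
      rw [e1, hE, ← e2] at h3
      exact h3)
    (by
      have h3 := hv2.le
      have e1 : ∑ i, φ l (c i) * star (φ l (c i)) - 1 = φ l (∑ i, c i * star (c i) - 1) := by
        simp [map_star]
      have e2 : ∑ i, E (c i) * star (E (c i)) - 1 = E (∑ i, c i * star (c i) - 1) := by
        simp [map_star]
      rw [e1, hE, ← e2] at h3
      exact h3)
  refine ⟨F.comp χ, fun i => ?_⟩
  have e3 : ‖φ l (F (χ (Matrix.single i o 1)) - c i)‖ ≤ ε / 2 := by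
    rw [hE, map_sub, hEF]
    exact hχ i
  calc ‖φ l (F (χ (Matrix.single i o 1))) - ψ (Matrix.single i o 1)‖
      = ‖φ l (F (χ (Matrix.single i o 1)) - c i) + (φ l (c i) - e i)‖ := by
        rw [map_sub]; congr 1; abel
    _ ≤ ε / 2 + ε / 2 :=
      (norm_add_le _ _).trans (add_le_add e3 ((hc i).le.trans (min_le_right _ _)))
    _ = ε := add_halves ε

/-- In a UHF algebra, all unital copies of a matrix algebra are unitarily conjugate. -/
theorem exists_unitary_conj (hinj : ∀ n, Function.Injective (φ n))
    (hmono : Monotone fun n => Set.range (φ n)) (hdense : Dense (⋃ n, Set.range (φ n)))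
    {n : Type*} [Fintype n] [DecidableEq n] (o : n) (χ ψ : Matrix n n ℂ →⋆ₐ[ℂ] A) :
    ∃ w : unitary A, ∀ x, ψ x = (w : A) * χ x * star (w : A) := by
  have hε : 0 < 1 / ((Fintype.card n : ℝ) + 1) := by positivity
  have hε1 : Fintype.card n * (1 / ((Fintype.card n : ℝ) + 1)) < 1 := by
    rw [mul_one_div, div_lt_one (by positivity)]; linarith
  obtain ⟨N₁, h₁⟩ := exists_factor_near hinj hmono hdense o χ hε
  obtain ⟨N₂, h₂⟩ := exists_factor_near hinj hmono hdense o ψ hε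
  obtain ⟨l, hl₁, hl₂⟩ : ∃ l, N₁ ≤ l ∧ N₂ ≤ l := ⟨_, le_max_left _ _, le_max_right _ _⟩
  obtain ⟨χ', hχ'⟩ := h₁ l hl₁
  obtain ⟨ψ', hψ'⟩ := h₂ l hl₂
  obtain ⟨s, hs, hsi⟩ := exists_isUnit_intertwines χ' ψ' o
  obtain ⟨w₁, hw₁⟩ := exists_unitary_of_near χ ((φ l).comp χ') o hε1 hχ'
  obtain ⟨w₂, hw₂⟩ := exists_unitary_of_isUnit ((φ l).comp χ') ((φ l).comp ψ') (hs.map (φ l))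
    (fun x => by
      simp only [StarAlgHom.comp_apply]
      rw [← map_mul, hsi, map_mul])
  obtain ⟨w₃, hw₃⟩ := exists_unitary_of_near ((φ l).comp ψ') ψ o hε1
    (fun i => by rw [norm_sub_rev]; exact hψ' i)
  refine ⟨w₃ * w₂ * w₁, fun x => ?_⟩
  rw [hw₃, hw₂, hw₁]
  simp only [Submonoid.coe_mul, star_mul, mul_assoc]

end UHF

/-! ### Formulas measuring the distance to unital copies of a matrix algebra -/

namespace CStarLogic

/-- `v` is approximately the first column of a system of matrix units (relations weighted by `C`),
and the tuple `y` is approximately given by the matrices `c`. -/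
def IsApproxColumn {n k : ℕ} (o : Fin k) (C : ℕ) (c : Fin n → Matrix (Fin k) (Fin k) ℂ)
    {B : Type v} [NonUnitalCStarAlgebra B] (y : Fin n → B) (v : Fin k → B) (s : ℝ) : Prop :=
  (∀ i j, C * ‖star (v i) * v j - if i = j then v o else 0‖ ≤ s) ∧
  (∀ z : B, ‖z‖ ≤ 1 → C * ‖(∑ i, v i * star (v i)) * z - z‖ ≤ s) ∧
  ∀ l, ‖y l - ∑ a, ∑ b, c l a b • (v a * star (v b))‖ ≤ s

section Formulas

variable {n k : ℕ}

/-- The variable for the `i`-th entry of a column. -/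
def columnVar (n : ℕ) (i : Fin k) : Term (n + k + 1) := .var (Fin.castSucc (Fin.natAdd n i))

/-- The conditions in `IsApproxColumn`, as formulas in `y`, `v` and the auxiliary variable `z`. -/
noncomputable def columnRelations (o : Fin k) (C : ℕ) (c : Fin n → Matrix (Fin k) (Fin k) ℂ) :
    List (Formula (n + k + 1)) :=
  (Finset.univ : Finset (Fin k × Fin k)).toList.map (fun p => .norm (.smul (C : ℂ)
    (.add (.mul (.star (columnVar n p.1)) (columnVar n p.2))
      (if p.1 = p.2 then .smul (-1) (columnVar n o) else .zero)))) ++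
  (.norm (.smul (C : ℂ) (.add (.mul
      (Term.sum fun i : Fin k => .mul (columnVar n i) (.star (columnVar n i)))
      (.var (Fin.last (n + k)))) (.smul (-1) (.var (Fin.last (n + k)))))) ::
  (Finset.univ : Finset (Fin n)).toList.map (fun l => .norm (.add
    (.var (Fin.castSucc (Fin.castAdd k l)))
    (.smul (-1) (Term.sum fun a : Fin k => Term.sum fun b : Fin k =>
      .smul (c l a b) (.mul (columnVar n a) (.star (columnVar n b))))))))

/-- The formula measuring how far `y` is from a tuple given by the matrices `c` in a unital copy
of a matrix algebra. -/
noncomputable def matricialDist (o : Fin k) (C : ℕ) (c : Fin n → Matrix (Fin k) (Fin k) ℂ) :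
    Formula n :=
  .infs k (.sup 1 (.max (columnRelations o C c)))

variable {B : Type v} [NonUnitalCStarAlgebra B] (o : Fin k) (C : ℕ)
  (c : Fin n → Matrix (Fin k) (Fin k) ℂ)

theorem eval_columnVar (y : Fin n → B) (v : Fin k → B) (z : B) (i : Fin k) :
    (columnVar n i).eval (Fin.snoc (α := fun _ => B) (Fin.append y v) z) = v i := by
  rw [columnVar, Term.eval, Fin.snoc_castSucc, Fin.append_right]

/-- The unit is not a symbol of the language, so `∑ v v* = 1` is tested by multiplication on all `z`
in the unit ball. The relations not involving `z` are read off at `z = 0`. -/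
theorem eval_sup_columnRelations_le_iff (y : Fin n → B) (v : Fin k → B) (s : ℝ≥0) :
    (Formula.sup 1 (.max (columnRelations o C c))).eval (Fin.append y v) ≤ s ↔
      IsApproxColumn o C c y v s := by
  have key : ∀ z : B, (Formula.max (columnRelations o C c)).eval
      (Fin.snoc (α := fun _ => B) (Fin.append y v) z) ≤ s ↔
      (∀ i j, C * ‖star (v i) * v j - if i = j then v o else 0‖ ≤ s) ∧
      C * ‖(∑ i, v i * star (v i)) * z - z‖ ≤ s ∧
      ∀ l, ‖y l - ∑ a, ∑ b, c l a b • (v a * star (v b))‖ ≤ s := fun z => by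
    have h1 : ∀ i j : Fin k, (if i = j then Term.smul (-1) (columnVar n o) else .zero).eval
        (Fin.snoc (α := fun _ => B) (Fin.append y v) z) = -(if i = j then v o else 0) := by
      intro i j
      split_ifs
      · rw [Term.eval, eval_columnVar, neg_one_smul]
      · rw [Term.eval, neg_zero]
    rw [Formula.eval_max_le_iff, columnRelations, List.forall_mem_append, List.forall_mem_cons]
    simp only [List.forall_mem_map, Finset.mem_toList, Finset.mem_univ, true_implies, Prod.forall,
      Formula.eval, Term.eval, Term.eval_sum, eval_columnVar, h1, neg_one_smul,
      Fin.snoc_last, Fin.snoc_castSucc, Fin.append_left, ← sub_eq_add_neg, ← NNReal.coe_le_coe,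
      coe_nnnorm, norm_smul, Complex.norm_natCast]
  rw [Formula.eval_sup_le_iff]
  simp only [key, Nat.cast_one, IsApproxColumn]
  constructor
  · intro h
    exact ⟨(h 0 (by simp)).1, fun z hz => (h z hz).2.1, (h 0 (by simp)).2.2⟩
  · exact fun h z hz => ⟨h.1, h.2.1 z hz, h.2.2⟩

theorem exists_of_eval_matricialDist_lt {y : Fin n → B} {s : ℝ≥0}
    (h : (matricialDist o C c).eval y < s) :
    ∃ v : Fin k → B, (∀ i, ‖v i‖ ≤ 1) ∧ IsApproxColumn o C c y v s := by
  obtain ⟨v, hv, h⟩ := (Formula.eval_infs_lt_iff _ _ _).1 h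
  exact ⟨v, hv, (eval_sup_columnRelations_le_iff o C c y v s).1 h.le⟩

theorem eval_matricialDist_le {y : Fin n → B} {s : ℝ≥0} {v : Fin k → B} (hv : ∀ i, ‖v i‖ ≤ 1)
    (h : IsApproxColumn o C c y v s) : (matricialDist o C c).eval y ≤ s :=
  le_of_forall_gt fun _ ht => (Formula.eval_infs_lt_iff _ _ _).2
    ⟨v, hv, ((eval_sup_columnRelations_le_iff o C c y v s).2 h).trans_lt ht⟩

/-- The tuple `y` enters only the last, unweighted relations, so the same near-optimal column `v`
serves for both tuples. -/
theorem eval_matricialDist_le_add_dist (y y' : Fin n → B) :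
    ((matricialDist o C c).eval y : ℝ) ≤ (matricialDist o C c).eval y' + dist y y' := by
  refine le_of_forall_pos_le_add fun ε hε => ?_
  obtain ⟨v, hv, h1, h2, h3⟩ := exists_of_eval_matricialDist_lt o C c (y := y')
    (s := (matricialDist o C c).eval y' + ⟨ε, hε.le⟩) (lt_add_of_pos_right _ hε)
  have hs : (((matricialDist o C c).eval y' + ⟨ε, hε.le⟩ : ℝ≥0) : ℝ) =
    (matricialDist o C c).eval y' + ε := rfl
  rw [hs] at h1 h2 h3
  have h4 : IsApproxColumn o C c y v
      (((matricialDist o C c).eval y' + ⟨ε, hε.le⟩ + nndist y y' : ℝ≥0) : ℝ) := by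
    have hd : 0 ≤ dist y y' := dist_nonneg
    have hs' : (((matricialDist o C c).eval y' + ⟨ε, hε.le⟩ + nndist y y' : ℝ≥0) : ℝ) =
      (matricialDist o C c).eval y' + ε + dist y y' := rfl
    rw [hs']
    refine ⟨fun i j => (h1 i j).trans (by linarith), fun z hz => (h2 z hz).trans (by linarith),
      fun l => ?_⟩
    have h5 : ‖y l - y' l‖ ≤ dist y y' := by rw [← dist_eq_norm]; exact dist_le_pi_dist y y' l
    calc _ = ‖(y' l - ∑ a, ∑ b, c l a b • (v a * star (v b))) + (y l - y' l)‖ := by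
          congr 1; abel
      _ ≤ _ := (norm_add_le _ _).trans (add_le_add (h3 l) h5)
  have h5 : ((matricialDist o C c).eval y : ℝ) ≤ (matricialDist o C c).eval y' + ε + dist y y' :=
    eval_matricialDist_le o C c hv h4
  linarith

end Formulas

section Unital

variable {n k : ℕ} {B : Type v} [CStarAlgebra B] (o : Fin k) (C : ℕ)
  (c : Fin n → Matrix (Fin k) (Fin k) ℂ)

theorem eval_matricialDist_le_of_starAlgHom (ψ : Matrix (Fin k) (Fin k) ℂ →⋆ₐ[ℂ] B)
    {y : Fin n → B} {s : ℝ≥0} (h : ∀ l, ‖y l - ψ (c l)‖ ≤ s) :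
    (matricialDist o C c).eval y ≤ s := by
  refine eval_matricialDist_le o C c (v := fun i => ψ (Matrix.single i o 1))
    (fun i => norm_map_single_le ψ i o) ⟨fun i j => ?_, fun z _ => ?_, fun l => ?_⟩
  · rw [star_map_single_mul, sub_self, norm_zero, mul_zero]; exact s.2
  · rw [sum_map_single_mul_star, one_mul, sub_self, norm_zero, mul_zero]; exact s.2
  · rw [← map_eq_sum_column]; exact h l

theorem norm_sum_smul_sub_le {v w : Fin k → B} {ε : ℝ} (hv : ∀ i, ‖v i‖ ≤ 1)
    (hw : ∀ i, ‖w i‖ ≤ 1) (h : ∀ i, ‖v i - w i‖ ≤ ε) (x : Matrix (Fin k) (Fin k) ℂ) :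
    ‖∑ a, ∑ b, x a b • (v a * star (v b)) - ∑ a, ∑ b, x a b • (w a * star (w b))‖ ≤
      (∑ a, ∑ b, ‖x a b‖) * (4 * ε) := by
  simp only [← Finset.sum_sub_distrib, ← smul_sub, Finset.sum_mul]
  refine norm_sum_le_of_le _ fun a _ => norm_sum_le_of_le _ fun b _ => ?_
  rw [norm_smul]
  refine mul_le_mul_of_nonneg_left ?_ (norm_nonneg _)
  exact norm_mul_star_sub_le ((hv a).trans one_le_two) ((hw b).trans one_le_two) (h a) (h b)

/-- If the formula `matricialDist` is small at `y`, then `y` is close to a tuple given by the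
matrices `c`; here `C` has to be large, and the estimate is uniform over all C*-algebras. -/
theorem exists_starAlgHom_of_matricialDist_lt {ε : ℝ} (hε : 0 < ε) (M : ℝ) :
    ∃ C : ℕ, 0 < C ∧ ∀ (B : Type v) [CStarAlgebra B] (y : Fin n → B) (s : ℝ≥0), s ≤ M →
      (matricialDist o C c).eval y < s →
      ∃ ψ : Matrix (Fin k) (Fin k) ℂ →⋆ₐ[ℂ] B, ∀ l, ‖y l - ψ (c l)‖ ≤ s + ε := by
  let K : ℝ := ∑ l, ∑ a, ∑ b, ‖c l a b‖
  have hK : 0 ≤ K := by positivity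
  obtain ⟨δ, hδ, H⟩ := exists_starAlgHom_near.{v} (n := Fin k) o
    (ε := ε / (K + 1) / 4) (by positivity)
  -- With this weight, a value at most `M` forces the column relations to hold up to `δ`, while the
  -- distance from `y` stays unweighted.
  obtain ⟨C, hC⟩ := exists_nat_gt (M / δ)
  refine ⟨C + 1, Nat.succ_pos C, fun B _ y s hs h => ?_⟩
  obtain ⟨v, hv, h1, h2, h3⟩ := exists_of_eval_matricialDist_lt o (C + 1) c h
  have hC1 : (0 : ℝ) < ((C + 1 : ℕ) : ℝ) := by positivity
  have hle : ∀ x : ℝ, ((C + 1 : ℕ) : ℝ) * x ≤ s → x ≤ δ := fun x hx => by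
    refine le_of_mul_le_mul_left ((hx.trans hs).trans ?_) hC1
    rw [div_lt_iff₀ hδ] at hC
    push_cast
    nlinarith
  have h1' : ‖(1 : B)‖ ≤ 1 := norm_le_one_of_projection (IsSelfAdjoint.one B) (one_mul 1)
  obtain ⟨ψ, hψ⟩ := H B v (fun i j => hle _ (h1 i j)) (hle _ (by simpa using h2 1 h1'))
  refine ⟨ψ, fun l => ?_⟩
  have h4 := norm_sum_smul_sub_le hv (fun i => norm_map_single_le ψ i o)
    (fun i => by rw [norm_sub_rev]; exact hψ i) (c l)
  have h5 : (∑ a, ∑ b, ‖c l a b‖) * (4 * (ε / (K + 1) / 4)) ≤ ε := by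
    have h6 : (∑ a, ∑ b, ‖c l a b‖) ≤ K + 1 :=
      (Finset.single_le_sum (f := fun l => ∑ a, ∑ b, ‖c l a b‖) (fun l _ => by positivity)
        (Finset.mem_univ l)).trans (by linarith)
    calc _ ≤ (K + 1) * (4 * (ε / (K + 1) / 4)) := by gcongr
      _ = ε := by field_simp
  rw [map_eq_sum_column ψ o]
  calc _ = ‖(y l - ∑ a, ∑ b, c l a b • (v a * star (v b))) +
        (∑ a, ∑ b, c l a b • (v a * star (v b)) - ∑ a, ∑ b, c l a b •
          (ψ (Matrix.single a o 1) * star (ψ (Matrix.single b o 1))))‖ := by congr 1; abel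
    _ ≤ s + ε := (norm_add_le _ _).trans (add_le_add (h3 l) (h4.trans h5))

end Unital

/-- A C*-algebra with an approximate left unit is unital. -/
theorem exists_cstarAlgebra_of_left_unit {B : Type v} [inst : NonUnitalCStarAlgebra B] {e : B}
    (he : ∀ z : B, ‖z‖ ≤ 1 → ‖e * z - z‖ ≤ 1 / 2) :
    ∃ inst' : CStarAlgebra B, inst'.toNonUnitalCStarAlgebra = inst := by
  -- Left multiplication by `e` is invertible. The preimage `w` of `e` satisfies `e w z = e z`, so
  -- it is a left unit by injectivity, and then two-sided by taking adjoints.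
  have he' : ‖1 - ContinuousLinearMap.mul ℂ B e‖ < 1 := by
    refine lt_of_le_of_lt (ContinuousLinearMap.opNorm_le_of_unit_norm (C := 1 / 2)
      (by norm_num) fun z hz => ?_) (by norm_num : (1 / 2 : ℝ) < 1)
    have := he z hz.le
    rwa [norm_sub_rev] at this
  have hT : IsUnit (ContinuousLinearMap.mul ℂ B e) := by
    have := (Units.oneSub _ he').isUnit
    rwa [Units.val_oneSub, sub_sub_cancel] at this
  obtain ⟨T, hT⟩ := hT
  have hinj : ∀ x y : B, e * x = e * y → x = y := fun x y hxy => by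
    have h1 : (T : B →L[ℂ] B) x = (T : B →L[ℂ] B) y := by rw [hT]; exact hxy
    have h2 : ∀ x : B, (↑T⁻¹ : B →L[ℂ] B) ((T : B →L[ℂ] B) x) = x := fun x => by
      rw [← mul_apply_eq_comp, Units.inv_mul]; rfl
    rw [← h2 x, h1, h2]
  obtain ⟨w, hw⟩ : ∃ w : B, e * w = e := by
    refine ⟨(↑T⁻¹ : B →L[ℂ] B) e, ?_⟩
    change ContinuousLinearMap.mul ℂ B e ((↑T⁻¹ : B →L[ℂ] B) e) = e
    rw [← hT, ← mul_apply_eq_comp, Units.mul_inv]; rfl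
  have hleft : ∀ z, w * z = z := fun z => hinj _ _ (by rw [← mul_assoc, hw])
  have hright' : ∀ z, z * star w = z := fun z => by
    have := congrArg star (hleft (star z))
    rwa [star_mul, star_star] at this
  have hsa : star w = w := by rw [← hleft (star w), hright']
  have hright : ∀ z, z * w = z := fun z => by rw [← hsa]; exact hright' z
  -- Only the unit is added to the given structure, so the underlying non-unital algebra is
  -- definitionally unchanged.
  let R : NormedRing B := { inst with one := w, one_mul := hleft, mul_one := hright }
  let Alg : Algebra ℂ B := Algebra.ofModule smul_mul_assoc mul_smul_comm
  let NAlg : NormedAlgebra ℂ B := { Alg with norm_smul_le := norm_smul_le }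
  exact ⟨{ R, NAlg, inst with }, rfl⟩

end CStarLogic

/-! ### Models of the theory of a UHF algebra: embeddings and definable types -/

namespace CStarLogic

open scoped Topology
open Filter

variable {A : Type u} [CStarAlgebra A] {k : ℕ → ℕ}
  {φ : ∀ n, Matrix (Fin (k n)) (Fin (k n)) ℂ →⋆ₐ[ℂ] A}

/-- In a model of the theory of a UHF algebra `A`, all formulas take the same values on unital
copies of a matrix algebra as in `A`. -/
theorem eval_map_eq_of_isModel (hinj : ∀ n, Function.Injective (φ n))
    (hmono : Monotone fun n => Set.range (φ n)) (hdense : Dense (⋃ n, Set.range (φ n)))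
    {B : Type v} [CStarAlgebra B] (hB : IsModel (theoryOf A) B) {m n : ℕ} (o : Fin m)
    (χ : Matrix (Fin m) (Fin m) ℂ →⋆ₐ[ℂ] A) (θ : Matrix (Fin m) (Fin m) ℂ →⋆ₐ[ℂ] B)
    (c : Fin n → Matrix (Fin m) (Fin m) ℂ) (f : Formula n) :
    f.eval (fun i => θ (c i)) = f.eval (fun i => χ (c i)) := by
  set r := f.eval (fun i => χ (c i)) with hr
  suffices h : ∀ ε : ℝ≥0, 0 < ε → nndist (f.eval fun i => θ (c i)) r ≤ ε by
    have h0 : nndist (f.eval fun i => θ (c i)) r ≤ 0 := le_of_forall_gt_imp_ge_of_dense h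
    exact nndist_eq_zero.1 (le_zero_iff.1 h0)
  intro ε hε
  obtain ⟨η, hη, hball⟩ := Metric.continuous_iff.1 (f.continuous_eval (A := A))
    (fun i => χ (c i)) ε hε
  obtain ⟨C, -, hC⟩ := exists_starAlgHom_of_matricialDist_lt.{u} o c (half_pos hη) 1
  let s : ℝ≥0 := min 1 ⟨η / 4, by positivity⟩
  have hs0 : 0 < s := lt_min one_pos (by exact_mod_cast (by positivity : 0 < η / 4))
  have hs1 : (s : ℝ) ≤ 1 := by exact_mod_cast min_le_left (1 : ℝ≥0) _
  have hs2 : (s : ℝ) ≤ η / 4 := by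
    have : s ≤ ⟨η / 4, by positivity⟩ := min_le_right _ _
    exact_mod_cast this
  -- Such a `y` is near some `ψ ∘ c`; an inner automorphism carrying `χ` to `ψ` brings it within `s
  -- + η / 2 < η` of `χ ∘ c` without changing the value of `f`.
  have hA : ∀ y : Fin n → A, (matricialDist o C c).eval y < s → nndist (f.eval y) r ≤ ε := by
    intro y hy
    obtain ⟨ψ, hψ⟩ := hC A y s hs1 hy
    obtain ⟨w, hw⟩ := exists_unitary_conj hinj hmono hdense o χ ψ
    let α := Unitary.conjStarAlgAut ℂ A w
    have hα : ∀ x, ψ x = α (χ x) := hw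
    have hy' : f.eval y = f.eval fun i => α.symm (y i) := (Formula.eval_equiv α.symm f y).symm
    rw [hy']
    refine (hball _ ?_).le
    rw [dist_pi_lt_iff hη]
    intro i
    have h1 : ‖α (α.symm (y i) - χ (c i))‖ ≤ s + η / 2 := by
      rw [map_sub, StarAlgEquiv.apply_symm_apply, ← hα]; exact hψ i
    rw [StarAlgEquiv.norm_map] at h1
    rw [dist_eq_norm]
    linarith
  -- With truncated subtraction, `g` vanishes exactly when `p.2 < s` implies `nndist p.1 r ≤ ε`. The
  -- implication `hA` thus becomes a sentence of value 0.
  let g : C(ℝ≥0 × ℝ≥0, ℝ≥0) := ⟨fun p => min (nndist p.1 r - ε) (s - p.2), by fun_prop⟩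
  obtain ⟨R, hR⟩ := exists_norm_le fun i => θ (c i)
  have hσA : (Formula.sups R (.conn g f (matricialDist o C c))).eval (Fin.elim0 : Fin 0 → A) ≤ 0 := by
    rw [Formula.eval_sups_le_iff]
    intro y _
    change min (nndist (f.eval y) r - ε) (s - (matricialDist o C c).eval y) ≤ 0
    by_cases hy : (matricialDist o C c).eval y < s
    · exact (min_le_left _ _).trans (tsub_eq_zero_of_le (hA y hy)).le
    · exact (min_le_right _ _).trans (tsub_eq_zero_of_le (not_lt.1 hy)).le
  rw [← hB.eval_eq, Formula.eval_sups_le_iff] at hσA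
  have h1 : min (nndist (f.eval fun i => θ (c i)) r - ε)
    (s - (matricialDist o C c).eval fun i => θ (c i)) ≤ 0 := hσA _ hR
  have h2 : (matricialDist o C c).eval (fun i => θ (c i)) = 0 :=
    le_zero_iff.1 (eval_matricialDist_le_of_starAlgHom o C c θ fun l => by simp)
  rw [h2, tsub_zero, min_le_iff] at h1
  exact tsub_eq_zero_iff_le.1 (le_zero_iff.1 (h1.resolve_right (not_le.2 hs0)))

theorem norm_map_eq_of_isModel (hinj : ∀ n, Function.Injective (φ n))
    (hmono : Monotone fun n => Set.range (φ n)) (hdense : Dense (⋃ n, Set.range (φ n)))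
    {B : Type v} [CStarAlgebra B] (hB : IsModel (theoryOf A) B) {m : ℕ} (o : Fin m)
    (χ : Matrix (Fin m) (Fin m) ℂ →⋆ₐ[ℂ] A) (θ : Matrix (Fin m) (Fin m) ℂ →⋆ₐ[ℂ] B)
    (x : Matrix (Fin m) (Fin m) ℂ) : ‖θ x‖ = ‖χ x‖ :=
  congrArg NNReal.toReal (eval_map_eq_of_isModel hinj hmono hdense hB o χ θ (fun _ : Fin 1 => x)
    (.norm (.var 0)))

/-- Models of the theory of a unital C*-algebra that contains a unital copy of a matrix algebra
are unital. -/
theorem IsModel.exists_cstarAlgebra {m : ℕ} (o : Fin m)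
    (χ : Matrix (Fin m) (Fin m) ℂ →⋆ₐ[ℂ] A) {B : Type v} [inst : NonUnitalCStarAlgebra B]
    (hB : IsModel (theoryOf A) B) :
    ∃ inst' : CStarAlgebra B, inst'.toNonUnitalCStarAlgebra = inst := by
  have h : (matricialDist o 1 (Fin.elim0 : Fin 0 → _)).eval (Fin.elim0 : Fin 0 → B) <
      (⟨1 / 2, by norm_num⟩ : ℝ≥0) := by
    rw [hB.eval_eq]
    refine (eval_matricialDist_le_of_starAlgHom o 1 _ χ (s := 0) fun l => l.elim0).trans_lt ?_
    exact (by norm_num : (0 : ℝ) < 1 / 2)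
  obtain ⟨v, -, -, hv, -⟩ := exists_of_eval_matricialDist_lt _ _ _ h
  exact exists_cstarAlgebra_of_left_unit fun z hz => by
    have := hv z hz
    rwa [Nat.cast_one, one_mul] at this

/-- A matrix algebra that embeds unitally into a C*-algebra embeds unitally into all unital models
of its theory. -/
theorem IsModel.exists_starAlgHom {m : ℕ} (o : Fin m)
    (χ : Matrix (Fin m) (Fin m) ℂ →⋆ₐ[ℂ] A) {B : Type v} [CStarAlgebra B]
    (hB : IsModel (theoryOf A) B) : Nonempty (Matrix (Fin m) (Fin m) ℂ →⋆ₐ[ℂ] B) := by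
  obtain ⟨C, -, hC⟩ :=
    exists_starAlgHom_of_matricialDist_lt.{v} o (Fin.elim0 : Fin 0 → _) one_pos 1
  obtain ⟨ψ, -⟩ := hC B Fin.elim0 1 (by simp) (by
    rw [hB.eval_eq]
    exact (eval_matricialDist_le_of_starAlgHom o C _ χ (s := 0) fun l => l.elim0).trans_lt one_pos)
  exact ⟨ψ⟩

/-- Compression gives `e_ii x e_ji = x_ij e_ii`, matrix units have norm at most 1, and a nonzero
idempotent has norm at least 1. -/
theorem norm_entry_le {m : ℕ} {χ : Matrix (Fin m) (Fin m) ℂ →⋆ₐ[ℂ] A}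
    (hχ : Function.Injective χ) (x : Matrix (Fin m) (Fin m) ℂ) (i j : Fin m) :
    ‖x i j‖ ≤ ‖χ x‖ := by
  have h1 : χ (Matrix.single i i 1) ≠ 0 := by
    rw [Ne, ← map_zero χ, hχ.eq_iff]
    intro h
    simpa using congrFun (congrFun h i) i
  have h2 : 1 ≤ ‖χ (Matrix.single i i 1)‖ := by
    by_contra h
    refine h1 (eq_zero_of_isIdempotentElem_of_norm_lt ?_ (not_le.1 h))
    rw [IsIdempotentElem, ← map_mul]; simp
  have h3 : χ (Matrix.single i i 1) * χ x * χ (Matrix.single j i 1) =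
      x i j • χ (Matrix.single i i 1) := by
    rw [← map_mul, ← map_mul, ← map_smul]
    congr 1
    rw [Matrix.single_mul_mul_single, Matrix.smul_single]
    simp
  calc ‖x i j‖ ≤ ‖x i j‖ * ‖χ (Matrix.single i i 1)‖ := le_mul_of_one_le_right (norm_nonneg _) h2
    _ = ‖χ (Matrix.single i i 1) * χ x * χ (Matrix.single j i 1)‖ := by rw [h3, norm_smul]
    _ ≤ 1 * ‖χ x‖ * 1 := by
      refine (norm_mul_le _ _).trans ?_
      gcongr
      · refine (norm_mul_le _ _).trans ?_
        gcongr
        exact norm_map_single_le χ i i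
      · exact norm_map_single_le χ j i
    _ = ‖χ x‖ := by ring

/-- Unital *-homomorphisms into models extend approximately along the defining sequence. -/
theorem exists_extension_step (hpos : ∀ n, 0 < k n) (hinj : ∀ n, Function.Injective (φ n))
    (hmono : Monotone fun n => Set.range (φ n)) (hdense : Dense (⋃ n, Set.range (φ n)))
    {B : Type v} [CStarAlgebra B] (hB : IsModel (theoryOf A) B) (n : ℕ)
    (θ : Matrix (Fin (k n)) (Fin (k n)) ℂ →⋆ₐ[ℂ] B) {ε : ℝ} (hε : 0 < ε) :
    ∃ θ' : Matrix (Fin (k (n + 1))) (Fin (k (n + 1))) ℂ →⋆ₐ[ℂ] B, ∀ x x',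
      φ (n + 1) x' = φ n x → ‖θ' x' - θ x‖ ≤ ε * ‖φ n x‖ := by
  let o : Fin (k n) := ⟨0, hpos n⟩
  let o' : Fin (k (n + 1)) := ⟨0, hpos (n + 1)⟩
  have hd : ∀ i, ∃ d, φ (n + 1) d = φ n (Matrix.single i o 1) := fun i =>
    hmono n.le_succ ⟨_, rfl⟩
  choose d hd using hd
  let K : ℝ := ∑ _a : Fin (k n), ∑ _b : Fin (k n), 1
  have hK : 0 ≤ K := by positivity
  let η : ℝ := ε / (K + 1) / 4
  have hη : 0 < η := by positivity
  obtain ⟨C, -, hC⟩ := exists_starAlgHom_of_matricialDist_lt.{v} o' d (half_pos hη) 1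
  let s : ℝ≥0 := min 1 ⟨η / 2, by positivity⟩
  have hs0 : 0 < s := lt_min one_pos (by exact_mod_cast half_pos hη)
  have hs1 : (s : ℝ) ≤ 1 := by exact_mod_cast min_le_left (1 : ℝ≥0) _
  have hs2 : (s : ℝ) ≤ η / 2 := by
    have : s ≤ ⟨η / 2, by positivity⟩ := min_le_right _ _
    exact_mod_cast this
  -- In `A` the formula is 0 at the column of `φ n`, because that column is `φ (n + 1) ∘ d`. By
  -- transfer it is 0 at the column of `θ`.
  obtain ⟨θ', hθ'⟩ := hC B (fun i => θ (Matrix.single i o 1)) s hs1 (by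
    rw [eval_map_eq_of_isModel hinj hmono hdense hB o (φ n)]
    exact (eval_matricialDist_le_of_starAlgHom o' C d (φ (n + 1)) (s := 0)
      fun l => by rw [hd]; simp).trans_lt hs0)
  refine ⟨θ', fun x x' hx => ?_⟩
  have hx' : x' = ∑ a, ∑ b, x a b • (d a * star (d b)) := by
    apply hinj (n + 1)
    rw [hx, map_eq_sum_column (φ n) o]
    simp only [map_sum, map_smul, map_mul, map_star, hd]
  have h1 : θ' x' = ∑ a, ∑ b, x a b • (θ' (d a) * star (θ' (d b))) := by
    rw [hx']
    simp only [map_sum, map_smul, map_mul, map_star]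
  have hd1 : ∀ i, ‖θ' (d i)‖ ≤ 1 := fun i => by
    rw [norm_map_eq_of_isModel hinj hmono hdense hB o' (φ (n + 1)), hd]
    exact norm_map_single_le _ _ _
  rw [h1, map_eq_sum_column θ o]
  refine (norm_sum_smul_sub_le hd1 (fun i => norm_map_single_le θ i o) (ε := η)
    (fun i => by rw [norm_sub_rev]; linarith [hθ' i]) x).trans ?_
  have h2 : ∑ a, ∑ b, ‖x a b‖ ≤ (K + 1) * ‖φ n x‖ := by
    calc ∑ a, ∑ b, ‖x a b‖ ≤ ∑ _a : Fin (k n), ∑ _b : Fin (k n), 1 * ‖φ n x‖ := by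
          gcongr with a _ b _
          rw [one_mul]
          exact norm_entry_le (hinj n) x a b
      _ = K * ‖φ n x‖ := by simp only [K, Finset.sum_mul]
      _ ≤ (K + 1) * ‖φ n x‖ := by gcongr; linarith
  calc (∑ a, ∑ b, ‖x a b‖) * (4 * η) ≤ (K + 1) * ‖φ n x‖ * (4 * η) := by gcongr
    _ = ε * ‖φ n x‖ := by simp only [η]; field_simp

/-- Approximately coherent unital *-homomorphisms on the defining sequence of a UHF algebra have a
limit, which is an elementary embedding. -/
theorem exists_elementary_limit (hpos : ∀ n, 0 < k n) (hinj : ∀ n, Function.Injective (φ n))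
    (hmono : Monotone fun n => Set.range (φ n)) (hdense : Dense (⋃ n, Set.range (φ n)))
    {B : Type v} [CStarAlgebra B] (hB : IsModel (theoryOf A) B) {ε : ℝ} (hε : 0 < ε)
    (θ : ∀ n, Matrix (Fin (k n)) (Fin (k n)) ℂ →⋆ₐ[ℂ] B)
    (hθ : ∀ n x x', φ (n + 1) x' = φ n x → ‖θ (n + 1) x' - θ n x‖ ≤ ε / 2 / 2 ^ n * ‖φ n x‖) :
    ∃ j : A →⋆ₙₐ[ℂ] B, IsElementary j ∧ ∀ x, ‖j (φ 0 x) - θ 0 x‖ ≤ ε * ‖φ 0 x‖ := by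
  have hnorm : ∀ n x, ‖θ n x‖ = ‖φ n x‖ := fun n x =>
    norm_map_eq_of_isModel hinj hmono hdense hB ⟨0, hpos n⟩ (φ n) (θ n) x
  have hgeom : ∀ (N : ℕ) (x : ∀ i, Matrix (Fin (k (N + i))) (Fin (k (N + i))) ℂ) (a : A),
      (∀ i, φ (N + i) (x i) = a) → ∀ i,
      dist (θ (N + i) (x i)) (θ (N + (i + 1)) (x (i + 1))) ≤ ε * ‖a‖ / 2 / 2 ^ i := by
    intro N x a hx i
    rw [dist_comm, dist_eq_norm]
    refine (hθ (N + i) (x i) (x (i + 1)) ((hx (i + 1)).trans (hx i).symm)).trans ?_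
    rw [hx]
    have : ε / 2 / 2 ^ (N + i) ≤ ε / 2 / 2 ^ i := by
      gcongr
      · norm_num
      · omega
    calc _ ≤ ε / 2 / 2 ^ i * ‖a‖ := by gcongr
      _ = _ := by ring
  -- The limit map is defined through its graph: the algebraic laws then pass to limits termwise,
  -- `hRnorm` makes the relation single-valued, and no coherent choice of approximants is needed.
  let Rel : A → B → Prop := fun a b => ∃ x : ∀ n, Matrix (Fin (k n)) (Fin (k n)) ℂ,
    Tendsto (fun n => φ n (x n)) atTop (𝓝 a) ∧ Tendsto (fun n => θ n (x n)) atTop (𝓝 b)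
  have hRnorm : ∀ a b, Rel a b → ‖b‖ = ‖a‖ := by
    rintro a b ⟨x, hxa, hxb⟩
    refine tendsto_nhds_unique hxb.norm ?_
    simp only [hnorm]
    exact hxa.norm
  have hRadd : ∀ a b a' b', Rel a b → Rel a' b' → Rel (a + a') (b + b') := by
    rintro a b a' b' ⟨x, hxa, hxb⟩ ⟨y, hya, hyb⟩
    exact ⟨fun n => x n + y n, by simpa only [map_add] using hxa.add hya,
      by simpa only [map_add] using hxb.add hyb⟩
  have hRmul : ∀ a b a' b', Rel a b → Rel a' b' → Rel (a * a') (b * b') := by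
    rintro a b a' b' ⟨x, hxa, hxb⟩ ⟨y, hya, hyb⟩
    exact ⟨fun n => x n * y n, by simpa only [map_mul] using hxa.mul hya,
      by simpa only [map_mul] using hxb.mul hyb⟩
  have hRsmul : ∀ (r : ℂ) a b, Rel a b → Rel (r • a) (r • b) := by
    rintro r a b ⟨x, hxa, hxb⟩
    exact ⟨fun n => r • x n, by simpa only [map_smul] using hxa.const_smul r,
      by simpa only [map_smul] using hxb.const_smul r⟩
  have hRstar : ∀ a b, Rel a b → Rel (star a) (star b) := by
    rintro a b ⟨x, hxa, hxb⟩
    exact ⟨fun n => star (x n), by simpa only [map_star] using hxa.star,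
      by simpa only [map_star] using hxb.star⟩
  have hRuniq : ∀ a b b', Rel a b → Rel a b' → b = b' := by
    intro a b b' h h'
    have h1 := hRadd _ _ _ _ h (hRsmul (-1) _ _ h')
    have h2 := hRnorm _ _ h1
    rw [neg_one_smul, neg_one_smul, add_neg_cancel, norm_zero, norm_eq_zero] at h2
    exact eq_of_sub_eq_zero (by rwa [sub_eq_add_neg])
  have hRtot : ∀ a, ∃ b, Rel a b := by
    intro a
    have hx : ∀ n, ∃ x, dist a (φ n x) < Metric.infDist a (Set.range (φ n)) + 1 / (n + 1) := by
      intro n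
      obtain ⟨_, ⟨x, rfl⟩, hx⟩ := (Metric.infDist_lt_iff (Set.range_nonempty (φ n))).1
        (lt_add_of_pos_right (Metric.infDist a (Set.range (φ n))) (Nat.one_div_pos_of_nat (n := n)))
      exact ⟨x, hx⟩
    choose x hx using hx
    have hxa : Tendsto (fun n => φ n (x n)) atTop (𝓝 a) := by
      rw [Metric.tendsto_atTop]
      intro η hη
      obtain ⟨N₁, h₁⟩ := exists_approx_of_dense hmono hdense (fun _ : Unit => a) (half_pos hη)
      obtain ⟨N₂, h₂⟩ := exists_nat_one_div_lt (half_pos hη)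
      refine ⟨max N₁ N₂, fun n hn => ?_⟩
      obtain ⟨c, hc⟩ := h₁ n ((le_max_left _ _).trans hn)
      have h3 : Metric.infDist a (Set.range (φ n)) ≤ dist a (φ n (c ())) :=
        Metric.infDist_le_dist_of_mem ⟨_, rfl⟩
      have h4 := hc ()
      rw [← dist_eq_norm, dist_comm] at h4
      have h5 : (1 : ℝ) / (n + 1) ≤ 1 / (N₂ + 1) :=
        Nat.one_div_le_one_div ((le_max_right _ _).trans hn)
      rw [dist_comm]
      linarith [hx n]
    have hcau : CauchySeq fun n => θ n (x n) := by
      rw [Metric.cauchySeq_iff]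
      intro η hη
      obtain ⟨N, hN⟩ := exists_approx_of_dense hmono hdense (fun _ : Unit => a)
        (by positivity : 0 < η / 8)
      obtain ⟨c, hc⟩ := hN N le_rfl
      -- The sequence is compared with that of one fixed element near `a`, whose images are Cauchy
      -- by the geometric error bound; `hnorm` controls the difference.
      have hy : ∀ i, ∃ y, φ (N + i) y = φ N (c ()) := fun i => hmono (Nat.le_add_right N i) ⟨_, rfl⟩
      choose y hy using hy
      have hcy := cauchySeq_of_le_geometric_two (hgeom N y _ hy)
      obtain ⟨M₁, hM₁⟩ := Metric.cauchySeq_iff.1 hcy (η / 4) (by positivity)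
      obtain ⟨M₂, hM₂⟩ := Metric.tendsto_atTop.1 hxa (η / 8) (by positivity)
      have hclose : ∀ i, M₂ ≤ N + i → dist (θ (N + i) (x (N + i))) (θ (N + i) (y i)) ≤ η / 4 := by
        intro i hi
        rw [dist_eq_norm, ← map_sub, hnorm, map_sub, hy, ← dist_eq_norm]
        have h1 := hM₂ _ hi
        have h2 := hc ()
        rw [← dist_eq_norm, dist_comm] at h2
        linarith [dist_triangle (φ (N + i) (x (N + i))) a (φ N (c ()))]
      refine ⟨N + (M₁ + M₂), fun p hp q hq => ?_⟩
      obtain ⟨p, rfl⟩ := Nat.exists_eq_add_of_le ((Nat.le_add_right N _).trans hp)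
      obtain ⟨q, rfl⟩ := Nat.exists_eq_add_of_le ((Nat.le_add_right N _).trans hq)
      have h1 := hclose p (by omega)
      have h2 := hclose q (by omega)
      have h3 := hM₁ p (by omega) q (by omega)
      rw [dist_comm] at h2
      linarith [dist_triangle4 (θ (N + p) (x (N + p))) (θ (N + p) (y p)) (θ (N + q) (y q))
        (θ (N + q) (x (N + q)))]
    obtain ⟨b, hb⟩ := cauchySeq_tendsto_of_complete hcau
    exact ⟨b, x, hxa, hb⟩
  choose J hJ using hRtot
  have hJeq : ∀ a b, Rel a b → J a = b := fun a b h => hRuniq _ _ _ (hJ a) h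
  let j : A →⋆ₙₐ[ℂ] B :=
    { toFun := J
      map_smul' := fun r a => hJeq _ _ (hRsmul r _ _ (hJ a))
      map_zero' := norm_eq_zero.1 (by rw [hRnorm _ _ (hJ 0), norm_zero])
      map_add' := fun a b => hJeq _ _ (hRadd _ _ _ _ (hJ a) (hJ b))
      map_mul' := fun a b => hJeq _ _ (hRmul _ _ _ _ (hJ a) (hJ b))
      map_star' := fun a => hJeq _ _ (hRstar _ _ (hJ a)) }
  refine ⟨j, fun n f a => ?_, fun x => ?_⟩
  · choose x hxa hxb using fun i => hJ (a i)
    have h1 : Tendsto (fun m => f.eval fun i => φ m (x i m)) atTop (𝓝 (f.eval a)) :=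
      (f.continuous_eval.tendsto a).comp (tendsto_pi_nhds.2 hxa)
    have h2 : Tendsto (fun m => f.eval fun i => θ m (x i m)) atTop
        (𝓝 (f.eval fun i => J (a i))) :=
      (f.continuous_eval.tendsto _).comp (tendsto_pi_nhds.2 hxb)
    refine tendsto_nhds_unique h2 (h1.congr fun m => ?_)
    exact (eval_map_eq_of_isModel hinj hmono hdense hB ⟨0, hpos m⟩ (φ m) (θ m) _ f).symm
  · have hy : ∀ n, ∃ y, φ n y = φ 0 x := fun n => hmono (Nat.zero_le n) ⟨_, rfl⟩
    choose y hy using hy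
    have hgeom0 : ∀ n, dist (θ n (y n)) (θ (n + 1) (y (n + 1))) ≤ ε * ‖φ 0 x‖ / 2 / 2 ^ n := by
      intro n
      rw [dist_comm, dist_eq_norm]
      refine (hθ n (y n) (y (n + 1)) ((hy (n + 1)).trans (hy n).symm)).trans (le_of_eq ?_)
      rw [hy]; ring
    obtain ⟨b, hb⟩ := cauchySeq_tendsto_of_complete (cauchySeq_of_le_geometric_two hgeom0)
    have h1 := dist_le_of_le_geometric_two_of_tendsto₀ hgeom0 hb
    have h2 : J (φ 0 x) = b := hJeq _ _ ⟨y, by simp only [hy]; exact tendsto_const_nhds, hb⟩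
    change ‖J (φ 0 x) - θ 0 x‖ ≤ _
    rw [h2, ← dist_eq_norm, dist_comm, ← hinj 0 (hy 0)]
    rwa [← hy 0] at h1

/-- Every unital *-homomorphism from a matrix algebra of the defining sequence of a UHF algebra
into a model of its theory extends, up to a small error, to an elementary embedding. -/
theorem exists_elementary_extension (hpos : ∀ n, 0 < k n) (hinj : ∀ n, Function.Injective (φ n))
    (hmono : Monotone fun n => Set.range (φ n)) (hdense : Dense (⋃ n, Set.range (φ n)))
    {B : Type v} [CStarAlgebra B] (hB : IsModel (theoryOf A) B) (m : ℕ)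
    (θ₀ : Matrix (Fin (k m)) (Fin (k m)) ℂ →⋆ₐ[ℂ] B) {ε : ℝ} (hε : 0 < ε) :
    ∃ j : A →⋆ₙₐ[ℂ] B, IsElementary j ∧ ∀ x, ‖j (φ m x) - θ₀ x‖ ≤ ε * ‖φ m x‖ := by
  choose F hF using fun n θ => exists_extension_step hpos hinj hmono hdense hB (m + n) θ
    (by positivity : 0 < ε / 2 / 2 ^ n)
  let θ : ∀ n, Matrix (Fin (k (m + n))) (Fin (k (m + n))) ℂ →⋆ₐ[ℂ] B := fun n =>
    Nat.rec θ₀ (fun n t => F n t) n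
  refine exists_elementary_limit (k := fun n => k (m + n)) (φ := fun n => φ (m + n))
    (fun n => hpos _) (fun n => hinj _) (fun a b hab => hmono (Nat.add_le_add_left hab m)) ?_ hB hε θ
    (fun n => hF n (θ n))
  refine hdense.mono (Set.iUnion_subset fun n => ?_)
  exact (hmono (Nat.le_add_left n m)).trans
    (Set.subset_iUnion (fun n => Set.range (φ (m + n))) n)

theorem IsElementary.norm_map {B : Type v} [NonUnitalCStarAlgebra B] {j : A →⋆ₙₐ[ℂ] B}
    (hj : IsElementary j) (a : A) : ‖j a‖ = ‖a‖ :=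
  congrArg NNReal.toReal (hj 1 (.norm (.var 0)) fun _ => a)

theorem IsElementary.mem_realizations {B : Type v} [NonUnitalCStarAlgebra B] {j : A →⋆ₙₐ[ℂ] B}
    (hj : IsElementary j) {n : ℕ} {a : Fin n → A} (ha : a ∈ unitBall n A) :
    (fun i => j (a i)) ∈ realizations (typeOf a) B := by
  refine ⟨fun i => (hj.norm_map _).trans_le (ha i), fun c hc => ?_⟩
  cases c with
  | le f r => exact (hj n f a).trans_le hc
  | ge f r => exact hc.trans_eq (hj n f a).symm

theorem isModel_theoryOf_self : IsModel (theoryOf A) A := fun _ hc => hc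

theorem exists_elementary (hpos : ∀ n, 0 < k n) (hinj : ∀ n, Function.Injective (φ n))
    (hmono : Monotone fun n => Set.range (φ n)) (hdense : Dense (⋃ n, Set.range (φ n)))
    {B : Type v} [NonUnitalCStarAlgebra B] (hB : IsModel (theoryOf A) B) :
    ∃ j : A →⋆ₙₐ[ℂ] B, IsElementary j := by
  obtain ⟨_, rfl⟩ := hB.exists_cstarAlgebra ⟨0, hpos 0⟩ (φ 0)
  obtain ⟨θ⟩ := IsModel.exists_starAlgHom ⟨0, hpos 0⟩ (φ 0) hB
  obtain ⟨j, hj, -⟩ := exists_elementary_extension hpos hinj hmono hdense hB 0 θ one_pos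
  exact ⟨j, hj⟩

/-- Types of tuples in a UHF algebra are definable, up to any given error. -/
theorem exists_formula_near_infDist (hpos : ∀ n, 0 < k n) (hinj : ∀ n, Function.Injective (φ n))
    (hmono : Monotone fun n => Set.range (φ n)) (hdense : Dense (⋃ n, Set.range (φ n))) {n : ℕ}
    {a : Fin n → A} (ha : a ∈ unitBall n A) {ε : ℝ} (hε : 0 < ε) :
    ∃ f : Formula n, ∀ (B : Type v) [NonUnitalCStarAlgebra B], IsModel (theoryOf A) B →
      ∀ b ∈ unitBall n B,
        |(f.eval b : ℝ) - Metric.infDist b (realizations (typeOf a) B)| ≤ ε := by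
  -- The final error is at most `5 * η`. The bound `η ≤ 1` gives `‖φ m (c l)‖ ≤ 2` and keeps the
  -- relevant values of the formula, at most `η + 2 + η`, below the cutoff 4.
  let η : ℝ≥0 := ⟨min 1 (ε / 8), by positivity⟩
  have hη0 : (0 : ℝ) < η := lt_min one_pos (by positivity)
  have hη1 : (η : ℝ) ≤ 1 := min_le_left _ _
  have hη2 : (η : ℝ) ≤ ε / 8 := min_le_right _ _
  obtain ⟨m, hm⟩ := exists_approx_of_dense hmono hdense a hη0
  obtain ⟨c, hc⟩ := hm m le_rfl
  have hc' : ∀ l, ‖a l - φ m (c l)‖ ≤ η := fun l => by rw [norm_sub_rev]; exact (hc l).le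
  have hc2 : ∀ l, ‖φ m (c l)‖ ≤ 2 := fun l => by
    have h1 := norm_sub_norm_le (φ m (c l)) (a l)
    have h2 := hc l
    have h3 := ha l
    linarith
  let o : Fin (k m) := ⟨0, hpos m⟩
  obtain ⟨C, -, hC⟩ := exists_starAlgHom_of_matricialDist_lt.{v} o c hη0 4
  have hA : (matricialDist o C c).eval a ≤ η := eval_matricialDist_le_of_starAlgHom o C c (φ m) hc'
  refine ⟨matricialDist o C c, fun B _ hB b hb => ?_⟩
  obtain ⟨_, rfl⟩ := hB.exists_cstarAlgebra o (φ m)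
  obtain ⟨j₀, hj₀⟩ := exists_elementary hpos hinj hmono hdense hB
  have hne : (realizations (typeOf a) B).Nonempty := ⟨_, hj₀.mem_realizations ha⟩
  -- The bound `≤ η` at `a` is a condition in its type, hence holds at each realization `d`.
  have hupper : ∀ d ∈ realizations (typeOf a) B,
      ((matricialDist o C c).eval b : ℝ) ≤ η + dist b d := by
    intro d hd
    have h1 : ((matricialDist o C c).eval d : ℝ) ≤ η := hd.2 (.le (matricialDist o C c) η) hA
    have h2 := eval_matricialDist_le_add_dist o C c b d
    linarith
  have h1 : ((matricialDist o C c).eval b : ℝ) - η ≤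
      Metric.infDist b (realizations (typeOf a) B) :=
    (Metric.le_infDist hne).2 fun d hd => by linarith [hupper d hd]
  have h3 : ((matricialDist o C c).eval b : ℝ) ≤ η + 2 := by
    obtain ⟨d, hd⟩ := hne
    have h4 : dist b d ≤ 2 := by
      rw [dist_pi_le_iff zero_le_two]
      intro i
      have h5 := hb i
      have h6 := hd.1 i
      rw [dist_eq_norm]
      linarith [norm_sub_le (b i) (d i)]
    linarith [hupper d hd]
  obtain ⟨θ, hθ⟩ := hC B b ((matricialDist o C c).eval b + η) (by push_cast; linarith)
    (lt_add_of_pos_right _ hη0)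
  push_cast at hθ
  obtain ⟨j, hj, hjθ⟩ := exists_elementary_extension hpos hinj hmono hdense hB m θ hη0
  have h2 : Metric.infDist b (realizations (typeOf a) B) ≤
      (matricialDist o C c).eval b + 5 * η := by
    refine (Metric.infDist_le_dist_of_mem (hj.mem_realizations ha)).trans ?_
    rw [dist_pi_le_iff (by positivity)]
    intro l
    have e1 : ‖j (φ m (c l)) - j (a l)‖ ≤ η := by
      rw [← map_sub, hj.norm_map]; exact (hc l).le
    have e2 : ‖θ (c l) - j (φ m (c l))‖ ≤ η * 2 := by
      rw [norm_sub_rev]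
      exact (hjθ (c l)).trans (mul_le_mul_of_nonneg_left (hc2 l) hη0.le)
    rw [dist_eq_norm]
    calc ‖b l - j (a l)‖
        = ‖(b l - θ (c l)) + (θ (c l) - j (φ m (c l))) + (j (φ m (c l)) - j (a l))‖ := by
          congr 1; abel
      _ ≤ (matricialDist o C c).eval b + η + η + η * 2 + η :=
        (norm_add_le _ _).trans (add_le_add ((norm_add_le _ _).trans (add_le_add (hθ l) e2)) e1)
      _ = (matricialDist o C c).eval b + 5 * η := by ring
  rw [abs_le]
  constructor <;> linarith

end CStarLogic

theorem theorem4p4 (A : Type u) [CStarAlgebra A] (hA : IsSeparableUHF A) :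
    CStarLogic.IsPrimeModel.{u, v} (CStarLogic.theoryOf A) A ∧
    CStarLogic.IsAtomicModel.{u, v} (CStarLogic.theoryOf A) A ∧
    (∀ (k : ℕ) (φ ψ : Matrix (Fin k) (Fin k) ℂ →⋆ₐ[ℂ] A),
      ∃ w : unitary A, ∀ x, ψ x = (w : A) * φ x * star (w : A)) ∧
    (∀ m : ℕ, Dense (matricialTuples m A)) := by
  obtain ⟨k, φ, hpos, hinj, hmono, hdense⟩ := hA
  refine ⟨⟨CStarLogic.isModel_theoryOf_self, fun B _ hB =>
    CStarLogic.exists_elementary hpos hinj hmono hdense hB⟩,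
    ⟨CStarLogic.isModel_theoryOf_self, fun n a ha => ⟨fun B _ hB => ?_, ?_⟩⟩, fun l χ ψ => ?_,
    fun m => ?_⟩
  · obtain ⟨j, hj⟩ := CStarLogic.exists_elementary hpos hinj hmono hdense hB
    exact ⟨_, hj.mem_realizations ha⟩
  · choose f hf using fun i : ℕ => CStarLogic.exists_formula_near_infDist.{u, v} hpos hinj hmono
      hdense ha (Nat.one_div_pos_of_nat (α := ℝ) (n := i))
    refine ⟨f, fun ε hε => ?_⟩
    obtain ⟨N, hN⟩ := exists_nat_one_div_lt hε
    exact ⟨N, fun i hi B _ hB b hb =>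
      (hf i B hB b hb).trans ((Nat.one_div_le_one_div hi).trans hN.le)⟩
  · rcases Nat.eq_zero_or_pos l with rfl | hl
    -- For size 0 there is no index `o` for a first column, but the source is the zero ring and both
    -- maps are zero.
    · have h1 : ∀ χ : Matrix (Fin 0) (Fin 0) ℂ →⋆ₐ[ℂ] A, ∀ x, χ x = 0 := fun χ x => by
        rw [Subsingleton.elim x 0, map_zero]
      exact ⟨1, fun x => by rw [h1, h1]; simp⟩
    · exact exists_unitary_conj hinj hmono hdense ⟨0, hl⟩ χ ψ
  · rw [Metric.dense_iff]
    intro a ε hε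
    obtain ⟨N, hN⟩ := exists_approx_of_dense hmono hdense a hε
    obtain ⟨c, hc⟩ := hN N le_rfl
    refine ⟨fun i => φ N (c i), ?_, k N, φ N, hpos N, hinj N, fun i => ⟨_, rfl⟩⟩
    rw [Metric.mem_ball, dist_pi_lt_iff hε]
    exact fun i => by rw [dist_eq_norm]; exact hc i
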